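/- Let $f:\Sigma^2\to (M^3,g)$ be a $C^\infty$ frontal from an oriented $2$-manifold into an oriented Riemannian $3$-manifold with Levi-Civita connection $\nabla$, and let $\nu$ be a smooth unit normal vector field of $f$ near $p\in\Sigma^2$ (either of the two choices). Let $p$ be a non-degenerate singular point of $f$, i.e. $d\lambda(p)\neq0$ for $\lambda=\det_g(f_u,f_v,\nu)$. Let $\gamma(t)$ be a regular parametrization, with $\gamma(0)=p$, of the singular set near $p$, and put $\hat\gamma=f\circ\gamma$. Assume that $p$ is of the second kind, i.e. $\ker df(p)$ is spanned by $\gamma'(0)$, and that for $t\ne0$ near $0$ the point $\gamma(t)$ is of the first kind, i.e. $\ker df(\gamma(t))$ is not spanned by $\gamma'(t)$. For such $t\neq 0$ let $\eta$ be a non-vanishing vector field near $\gamma(t)$ that spans $\ker df$ along $\gamma$ and for which $(\gamma',\eta)$ is positively oriented; put $f_\eta=df(\eta)$, $f_{\eta\eta}=\nabla_\eta f_\eta$, $f_{\eta\eta\eta}=\nabla_\eta f_{\eta\eta}$, and \[ \kappa_c(\gamma(t))=\frac{|\hat\gamma'|^{3/2}\det_g(\hat\gamma',f_{\eta\eta},f_{\eta\eta\eta})}{|\hat\gamma'\times_g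 f_{\eta\eta}|^{5/2}},\quad \kappa_s(\gamma(t))=\operatorname{sgn}(d\lambda(\eta))\frac{\det_g(\hat\gamma',\hat\gamma'',\nu)}{|\hat\gamma'|^3},\quad \kappa_\nu(\gamma(t))=\frac{\langle\hat\gamma'',\nu\rangle}{|\hat\gamma'|^2},\quad \kappa_\Pi=\kappa_\nu\kappa_c, \] where $\hat\gamma''=\nabla_{\hat\gamma'}\hat\gamma'$. Let $(u,v)$ be positively oriented coordinates centered at $p$ such that $f_u(p)=0$, the $u$-axis is the singular set near $p$, and $|f_v(p)|=1$; put $\kappa_\nu(p)=\langle\nabla_{\partial_v}f_v,\nu\rangle/|f_v|^2$ at $p$. Let $H$ be the mean curvature of $f$. Then $2vH$, defined for $v\ne0$, has a limit $\kappa_H(p)$ at $p$; moreover $\kappa_s(\gamma(t))\neq0$ for $t\ne0$ near $0$, and \[ |\kappa_H(p)|=\lim_{t\to0}\frac{|\kappa_c(\gamma(t))|}{2|\kappa_s(\gamma(t))|^{1/2}}. \] In particular, if $\kappa_\nu(p)\kappa_H(p)\neq0$, then $\kappa_\Pi(\gamma(t))$ does not converge to $\kappa_\nu(p)\kappa_H(p)$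 as $t\to0$. -/

import Mathlib

open Filter Topology Set
open scoped Manifold ContDiff

noncomputable section

namespace Frontal

/-- The coordinate plane of the source surface and the coordinate space of the ambient manifold. -/
abbrev E2 : Type := EuclideanSpace ℝ (Fin 2)

abbrev E3 : Type := EuclideanSpace ℝ (Fin 3)

/-- Standard basis vectors. -/
def e2 (i : Fin 2) : E2 := EuclideanSpace.single i 1

def e3 (i : Fin 3) : E3 := EuclideanSpace.single i 1

/-! ### Riemannian geometry in one chart of the ambient 3-manifold

`G` is the metric tensor in the chart: `G z a b = ⟨a, b⟩` at the point with coordinates `z`. -/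

/-- The matrix `(g_{ij})` of the metric. -/
def gram (G : E3 → E3 →L[ℝ] E3 →L[ℝ] ℝ) (z : E3) : Matrix (Fin 3) (Fin 3) ℝ :=
  Matrix.of fun i j => G z (e3 i) (e3 j)

/-- The length `|a|` of a tangent vector. -/
def normG (G : E3 → E3 →L[ℝ] E3 →L[ℝ] ℝ) (z a : E3) : ℝ := Real.sqrt (G z a a)

/-- The Riemannian volume form `det_g`, for the orientation given by the chart. -/
def detG (G : E3 → E3 →L[ℝ] E3 →L[ℝ] ℝ) (z a b c : E3) : ℝ :=
  Real.sqrt (gram G z).det *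
    Matrix.det !![a 0, a 1, a 2; b 0, b 1, b 2; c 0, c 1, c 2]

/-- The vector product `a ×_g b`, with `⟨a ×_g b, c⟩ = det_g (a, b, c)` for all `c`. -/
def crossG (G : E3 → E3 →L[ℝ] E3 →L[ℝ] ℝ) (z a b : E3) : E3 :=
  WithLp.toLp 2 fun k => ∑ l, (gram G z)⁻¹ k l * detG G z a b (e3 l)

/-- The Christoffel symbols of the Levi-Civita connection, as a bilinear map: the `k`-th
component of `Γ(a, b)` is `½ ∑ g^{kl} (∂_a g(b, e_l) + ∂_b g(a, e_l) - ∂_l g(a, b))`. -/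
def christoffel (G : E3 → E3 →L[ℝ] E3 →L[ℝ] ℝ) (z a b : E3) : E3 :=
  WithLp.toLp 2 fun k => (1 / 2 : ℝ) * ∑ l, (gram G z)⁻¹ k l *
    (fderiv ℝ G z a b (e3 l) + fderiv ℝ G z b a (e3 l) - fderiv ℝ G z (e3 l) a b)

/-- The covariant derivative `∇_w V` at `x` of a vector field `V` along a map `c`, induced by the
Levi-Civita connection. -/
def covD {X : Type} [NormedAddCommGroup X] [NormedSpace ℝ X]
    (G : E3 → E3 →L[ℝ] E3 →L[ℝ] ℝ) (c : X → E3) (V : X → E3) (x w : X) : E3 :=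
  fderiv ℝ V x w + christoffel G (c x) (fderiv ℝ c x w) (V x)

/-! ### Invariants of a frontal in coordinates

`F` is the coordinate expression of the map, `N` that of the unit normal field. -/

/-- The coordinate derivatives: `pd F 0 = f_u`, `pd F 1 = f_v`. -/
def pd (F : E2 → E3) (i : Fin 2) (z : E2) : E3 := fderiv ℝ F z (e2 i)

/-- `lam = det_g (f_u, f_v, ν)`. -/
def lam (G : E3 → E3 →L[ℝ] E3 →L[ℝ] ℝ) (F N : E2 → E3) (z : E2) : ℝ :=
  detG G (F z) (pd F 0 z) (pd F 1 z) (N z)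

/-- Coefficients of the first fundamental form. -/
def firstFF (G : E3 → E3 →L[ℝ] E3 →L[ℝ] ℝ) (F : E2 → E3) (i j : Fin 2) (z : E2) : ℝ :=
  G (F z) (pd F i z) (pd F j z)

/-- Coefficients of the second fundamental form, `h_{ij} = -⟨f_i, ∇_j ν⟩`. -/
def secondFF (G : E3 → E3 →L[ℝ] E3 →L[ℝ] ℝ) (F N : E2 → E3) (i j : Fin 2) (z : E2) : ℝ :=
  - G (F z) (pd F i z) (covD G F N z (e2 j))

/-- The mean curvature (meaningful at regular points). -/
def meanCurvature (G : E3 → E3 →L[ℝ] E3 →L[ℝ] ℝ) (F N : E2 → E3) (z : E2) : ℝ :=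
  (firstFF G F 0 0 z * secondFF G F N 1 1 z - 2 * firstFF G F 0 1 z * secondFF G F N 0 1 z
      + firstFF G F 1 1 z * secondFF G F N 0 0 z) /
    (2 * (firstFF G F 0 0 z * firstFF G F 1 1 z - firstFF G F 0 1 z ^ 2))

/-- In coordinates `(u, v)` adapted at a singular point of the second kind (located at the origin),
`v H` extends continuously across the singular set `v = 0`; `κ_H` is twice the value at the origin
of this extension. -/
def IsKappaH (G : E3 → E3 →L[ℝ] E3 →L[ℝ] ℝ) (F N : E2 → E3) (κ : ℝ) : Prop :=
  Tendsto (fun z : E2 => 2 * (z 1 * meanCurvature G F N z)) (𝓝[{z : E2 | z 1 ≠ 0}] 0) (𝓝 κ)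

/-- The limiting normal curvature `⟨f_{ii}, ν⟩ / |f_i|²` at a rank one singular point `z`, where
`i` is the index of the coordinate for which `f_i ≠ 0`, the other coordinate vector being null. -/
def kappaNu (G : E3 → E3 →L[ℝ] E3 →L[ℝ] ℝ) (F N : E2 → E3) (i : Fin 2) (z : E2) : ℝ :=
  G (F z) (covD G F (pd F i) z (e2 i)) (N z) / normG G (F z) (pd F i z) ^ 2

/-- Velocity `\hat γ'` of the image `\hat γ = f ∘ γ`; `c` is the coordinate expression of `γ`. -/
def vel (F : E2 → E3) (c : ℝ → E2) (t : ℝ) : E3 := deriv (F ∘ c) t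

/-- Acceleration `\hat γ'' = ∇_{\hat γ'} \hat γ'`. -/
def acc (G : E3 → E3 →L[ℝ] E3 →L[ℝ] ℝ) (F : E2 → E3) (c : ℝ → E2) (t : ℝ) : E3 :=
  covD G (F ∘ c) (vel F c) t 1

/-- The limiting normal curvature `⟨\hat γ'', ν⟩ / |\hat γ'|²` along singular points of the
first kind. -/
def kappaNuCurve (G : E3 → E3 →L[ℝ] E3 →L[ℝ] ℝ) (F N : E2 → E3) (c : ℝ → E2) (t : ℝ) : ℝ :=
  G (F (c t)) (acc G F c t) (N (c t)) / normG G (F (c t)) (vel F c t) ^ 2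

/-- The singular curvature `sgn (dλ(η)) det_g (\hat γ', \hat γ'', ν) / |\hat γ'|³` (for an
arbitrary regular parameter of `\hat γ`). `η` is the coordinate expression of a null vector field
such that `(γ', η)` is positively oriented. -/
def kappaS (G : E3 → E3 →L[ℝ] E3 →L[ℝ] ℝ) (F N : E2 → E3) (c : ℝ → E2) (η : E2 → E2)
    (t : ℝ) : ℝ :=
  Real.sign (fderiv ℝ (lam G F N) (c t) (η (c t))) *
    detG G (F (c t)) (vel F c t) (acc G F c t) (N (c t)) / normG G (F (c t)) (vel F c t) ^ 3

/-- `f_η = df(η)`, `f_{ηη} = ∇_η f_η`, `f_{ηηη} = ∇_η f_{ηη}`. -/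
def fη (F : E2 → E3) (η : E2 → E2) (z : E2) : E3 := fderiv ℝ F z (η z)

def fηη (G : E3 → E3 →L[ℝ] E3 →L[ℝ] ℝ) (F : E2 → E3) (η : E2 → E2) (z : E2) : E3 :=
  covD G F (fη F η) z (η z)

def fηηη (G : E3 → E3 →L[ℝ] E3 →L[ℝ] ℝ) (F : E2 → E3) (η : E2 → E2) (z : E2) : E3 :=
  covD G F (fηη G F η) z (η z)

/-- The cuspidal curvature at the singular point `c t` of the first kind. `η` is the coordinate
expression of an extended null vector field such that `(γ', η)` is positively oriented. -/
def kappaC (G : E3 → E3 →L[ℝ] E3 →L[ℝ] ℝ) (F : E2 → E3) (c : ℝ → E2) (η : E2 → E2)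
    (t : ℝ) : ℝ :=
  normG G (F (c t)) (vel F c t) ^ (3 / 2 : ℝ) *
      detG G (F (c t)) (vel F c t) (fηη G F η (c t)) (fηηη G F η (c t)) /
    normG G (F (c t)) (crossG G (F (c t)) (vel F c t) (fηη G F η (c t))) ^ (5 / 2 : ℝ)

/-- The product curvature `κ_ν κ_c`. -/
def kappaPi (G : E3 → E3 →L[ℝ] E3 →L[ℝ] ℝ) (F N : E2 → E3) (c : ℝ → E2) (η : E2 → E2)
    (t : ℝ) : ℝ :=
  kappaNuCurve G F N c t * kappaC G F c η t

/-! ### Frontals on manifolds, and their coordinate expressions -/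

variable {S : Type*} [TopologicalSpace S] [ChartedSpace E2 S]
  {M : Type*} [TopologicalSpace M] [ChartedSpace E3 M] [IsManifold (𝓡 3) ∞ M]

/-- Smooth Riemannian metrics on `M`. -/
abbrev Metric (M : Type*) [TopologicalSpace M] [ChartedSpace E3 M] [IsManifold (𝓡 3) ∞ M] :=
  Bundle.ContMDiffRiemannianMetric (𝓡 3) ∞ E3 (fun q : M => TangentSpace (𝓡 3) q)

/-- Coordinate expression of `f` in the charts `x` of `S` and `y` of `M`. -/
def coordMap (x : OpenPartialHomeomorph S E2) (y : OpenPartialHomeomorph M E3) (f : S → M) :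
    E2 → E3 := fun z => y (f (x.symm z))

/-- Coordinate expression of the metric in the chart `y`. -/
def coordMetric (g : Metric M) (y : OpenPartialHomeomorph M E3) :
    E3 → E3 →L[ℝ] E3 →L[ℝ] ℝ := fun z =>
  let D : E3 →L[ℝ] E3 := mfderiv (𝓡 3) (𝓡 3) y.symm z
  let B : E3 →L[ℝ] E3 →L[ℝ] ℝ := g.inner (y.symm z)
  B.bilinearComp D D

/-- Coordinate expression of a vector field along `f`. -/
def coordNormal (x : OpenPartialHomeomorph S E2) (y : OpenPartialHomeomorph M E3) (f : S → M)
    (ν : ∀ q, TangentSpace (𝓡 3) (f q)) : E2 → E3 := fun z =>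
  (mfderiv (𝓡 3) (𝓡 3) y (f (x.symm z)) (ν (x.symm z)) : E3)

/-- Coordinate expression of a tangent vector of `S`. -/
def coordVec (x : OpenPartialHomeomorph S E2) (q : S) (w : TangentSpace (𝓡 2) q) : E2 :=
  (mfderiv (𝓡 2) (𝓡 2) x q w : E2)

/-- Coordinate expression of a vector field on `S`. -/
def coordField (x : OpenPartialHomeomorph S E2) (η : ∀ q : S, TangentSpace (𝓡 2) q) :
    E2 → E2 := fun z => coordVec x (x.symm z) (η (x.symm z))

/-- `ν` is a smooth unit normal vector field along `f` on the open set `U`. A smooth map `f` is a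
frontal if it has such fields near every point. -/
structure IsUnitNormalOn (g : Metric M) (f : S → M) (ν : ∀ q, TangentSpace (𝓡 3) (f q))
    (U : Set S) : Prop where
  smooth : ContMDiffOn (𝓡 2) (𝓡 3).tangent ∞
    (fun q => (⟨f q, ν q⟩ : TangentBundle (𝓡 3) M)) U
  unit : ∀ q ∈ U, g.inner (f q) (ν q) (ν q) = 1
  normal : ∀ q ∈ U, ∀ a : TangentSpace (𝓡 2) q,
    g.inner (f q) (mfderiv (𝓡 2) (𝓡 3) f q a) (ν q) = 0

/-- `q` is a singular point of `f`. -/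
def IsSingularPt (f : S → M) (q : S) : Prop :=
  ¬ Function.Injective (mfderiv (𝓡 2) (𝓡 3) f q)

/-- `q` is a non-degenerate singular point: `dλ ≠ 0` at `q` (in any local coordinates). -/
def IsNondegenerate [IsManifold (𝓡 2) ∞ S] (g : Metric M) (f : S → M)
    (ν : ∀ q, TangentSpace (𝓡 3) (f q)) (q : S) : Prop :=
  IsSingularPt f q ∧
    ∀ x ∈ IsManifold.maximalAtlas (𝓡 2) ∞ S, ∀ y ∈ IsManifold.maximalAtlas (𝓡 3) ∞ M,
      q ∈ x.source → f q ∈ y.source →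
        fderiv ℝ (lam (coordMetric g y) (coordMap x y f) (coordNormal x y f ν)) (x q) ≠ 0

/-- The velocity of a curve in `S`. -/
def velocity (γ : ℝ → S) (t : ℝ) : TangentSpace (𝓡 2) (γ t) :=
  mfderiv 𝓘(ℝ, ℝ) (𝓡 2) γ t (1 : ℝ)

/-- `γ`, restricted to `(-δ, δ)`, is a regular curve in the singular set of `f` with `γ(0) = p`
(so it parametrizes the singular set near `p` when `p` is non-degenerate). -/
structure IsSingularCurve (f : S → M) (p : S) (γ : ℝ → S) (δ : ℝ) : Prop where
  pos : 0 < δ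
  smooth : ContMDiffOn 𝓘(ℝ, ℝ) (𝓡 2) ∞ γ (Ioo (-δ) δ)
  base : γ 0 = p
  regular : ∀ t ∈ Ioo (-δ) δ, velocity γ t ≠ 0
  singular : ∀ t ∈ Ioo (-δ) δ, IsSingularPt f (γ t)

/-- `γ t` is a non-degenerate singular point of the first kind: the null vectors are not
proportional to the velocity of the singular curve. -/
def IsFirstKind [IsManifold (𝓡 2) ∞ S] (g : Metric M) (f : S → M)
    (ν : ∀ q, TangentSpace (𝓡 3) (f q)) (γ : ℝ → S) (t : ℝ) : Prop :=
  IsNondegenerate g f ν (γ t) ∧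
    ∀ w : TangentSpace (𝓡 2) (γ t), w ≠ 0 → mfderiv (𝓡 2) (𝓡 3) f (γ t) w = 0 →
      ¬ ∃ a : ℝ, w = a • velocity γ t

/-- `γ t` is a non-degenerate singular point of the second kind: the null vectors are
proportional to the velocity of the singular curve. -/
def IsSecondKind [IsManifold (𝓡 2) ∞ S] (g : Metric M) (f : S → M)
    (ν : ∀ q, TangentSpace (𝓡 3) (f q)) (γ : ℝ → S) (t : ℝ) : Prop :=
  IsNondegenerate g f ν (γ t) ∧
    ∃ w : TangentSpace (𝓡 2) (γ t), w ≠ 0 ∧ mfderiv (𝓡 2) (𝓡 3) f (γ t) w = 0 ∧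
      ∃ a : ℝ, w = a • velocity γ t

/-- `x = (u, v)` is an adapted coordinate system at the singular point `p` of the second kind:
`p` is the origin, `f_u(p) = 0`, the `u`-axis is the singular set near `p`, and `|f_v(p)| = 1`.
(`y` is an auxiliary chart of `M` at `f p`.) -/
structure IsAdapted [IsManifold (𝓡 2) ∞ S] (g : Metric M) (f : S → M) (p : S)
    (x : OpenPartialHomeomorph S E2) (y : OpenPartialHomeomorph M E3) : Prop where
  mem_atlas : x ∈ IsManifold.maximalAtlas (𝓡 2) ∞ S
  mem_source : p ∈ x.source
  centered : x p = 0
  fu : pd (coordMap x y f) 0 0 = 0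
  axis : ∀ᶠ q in 𝓝 p, IsSingularPt f q ↔ x q 1 = 0
  fv : normG (coordMetric g y) (coordMap x y f 0) (pd (coordMap x y f) 1 0) = 1

/-- `η` is an extended null vector field at `γ t`: a smooth non-vanishing vector field near `γ t`,
null along `γ`, such that `(γ', η)` is positively oriented (for the orientation of `S` given by the
chart `x`). -/
structure IsExtendedNull [IsManifold (𝓡 2) ∞ S] (f : S → M) (γ : ℝ → S) (x : OpenPartialHomeomorph S E2) (t : ℝ)
    (η : ∀ q : S, TangentSpace (𝓡 2) q) : Prop where
  smooth : ∃ W ∈ 𝓝 (γ t), ContMDiffOn (𝓡 2) (𝓡 2).tangent ∞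
    (fun q => (⟨q, η q⟩ : TangentBundle (𝓡 2) S)) W ∧ ∀ q ∈ W, η q ≠ 0
  null : ∀ᶠ s in 𝓝 t, mfderiv (𝓡 2) (𝓡 3) f (γ s) (η (γ s)) = 0
  oriented : ∀ᶠ s in 𝓝 t,
    0 < coordVec x (γ s) (velocity γ s) 0 * coordVec x (γ s) (η (γ s)) 1
      - coordVec x (γ s) (velocity γ s) 1 * coordVec x (γ s) (η (γ s)) 0

end Frontal

end

noncomputable section

namespace Frontal

/-! The proof rests on the frame `f_v × ν, f_v`, which is orthogonal, has two vectors of equal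
length, and does not degenerate at the singular set because `f_v(p) ≠ 0`. Write `f_u = h (f_v × ν) +
s f_v`, with `h = λ / |f_v|²` (`height`) and `s = ⟨f_u, f_v⟩ / |f_v|²` (`slope`). On the `u`-axis `h
= 0`, so `f_u = s f_v` and the null direction is `∂_u - s ∂_v`; points of the first kind have `s ≠
0`, and `s(p) = 0`. All invariants are computed from `s`, `λ_v`, `J = ⟨f_v × ν, ∇_v f_u⟩`
(`conormalAcc`) and `B_i = ⟨f_v × ν, ∇_i ν⟩` (`conormalFF`).

In the formula for `H` the denominator is `2λ²` and one factor `λ` cancels (`meanCurvature_eq`).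
What remains is `2vH = (v/λ)(h h_vv + s B_v - B_u)`, which tends to `-B_u(p) / λ_v(p)`.

Along the singular curve `|κ_s| = |J| / (|s| |f_v|³)` (`abs_kappaS`). The vector `f_ηη` and the
normal part of `f_ηηη` (`fηη_fηηη`) give `κ_c`. In `|κ_c| / (2 |κ_s|^{1/2})` the speed, the size of
`η` and the singular powers of `s` cancel, leaving `|B_u - s B_v| / √(|λ_v / |f_v|²| |J|)`
(`abs_kappaC_div`). At `p` one has `s = 0` and `|f_v| = 1`, and `λ_v = J` because `f_u(p) = 0`
(`fderiv_lam_eq_conormalAcc`); so the limit is `|B_u(p) / λ_v(p)|`, the modulus of the limit of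
`2vH`.

Finally `J(p) ≠ 0` and `s → 0` make `|κ_s|` tend to infinity, while `κ_ν` is continuous up to `p`
(`kappaNuCurve_eq`). Hence `|κ_Π| = |κ_ν| · (ratio) · 2 |κ_s|^{1/2}` is unbounded whenever `κ_ν(p)
κ_H(p) ≠ 0`. -/

/-- `G` is a smooth Riemannian metric on the open set `Y` of the coordinate space. -/
structure IsMetricOn (G : E3 → E3 →L[ℝ] E3 →L[ℝ] ℝ) (Y : Set E3) : Prop where
  isOpen : IsOpen Y
  smooth : ∀ z ∈ Y, ContDiffAt ℝ ∞ G z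
  symm : ∀ z ∈ Y, ∀ a b, G z a b = G z b a
  pos : ∀ z ∈ Y, ∀ a, a ≠ 0 → 0 < G z a a

/-! ### Linear algebra of a metric at one point -/

section Pointwise

variable {G : E3 → E3 →L[ℝ] E3 →L[ℝ] ℝ} {Y : Set E3} {z : E3}

theorem sum_apply_smul_e3 (a : E3) : ∑ i, a i • e3 i = a := by
  ext j
  fin_cases j <;> simp [e3, Fin.sum_univ_three]

theorem apply_eq_sum (L : E3 →L[ℝ] ℝ) (a : E3) : L a = ∑ i, a i * L (e3 i) := by
  conv_lhs => rw [← sum_apply_smul_e3 a]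
  simp

theorem ext_apply_e3 {L L' : E3 →L[ℝ] ℝ} (h : ∀ i, L (e3 i) = L' (e3 i)) (a : E3) :
    L a = L' a := by
  rw [apply_eq_sum L, apply_eq_sum L']
  simp [h]

theorem metric_apply_eq_sum (G : E3 → E3 →L[ℝ] E3 →L[ℝ] ℝ) (z a b : E3) :
    G z a b = ∑ i, ∑ j, a i * gram G z i j * b j := by
  have h : G z a b = (G z).flip b a := rfl
  rw [h, apply_eq_sum]
  refine Finset.sum_congr rfl fun i _ => ?_
  rw [ContinuousLinearMap.flip_apply, apply_eq_sum (G z (e3 i)) b, Finset.mul_sum]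
  refine Finset.sum_congr rfl fun j _ => ?_
  simp only [gram, Matrix.of_apply]
  ring

theorem IsMetricOn.gram_posDef (hG : IsMetricOn G Y) (hz : z ∈ Y) : (gram G z).PosDef := by
  refine Matrix.PosDef.of_dotProduct_mulVec_pos ?_ fun {w} hw => ?_
  · ext i j
    simp [gram, hG.symm z hz (e3 j) (e3 i)]
  · have h := hG.pos z hz (WithLp.toLp 2 w) (by simpa using hw)
    rw [metric_apply_eq_sum] at h
    simpa [dotProduct, Matrix.mulVec, Finset.mul_sum, mul_assoc] using h

theorem IsMetricOn.det_gram_pos (hG : IsMetricOn G Y) (hz : z ∈ Y) : 0 < (gram G z).det :=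
  (hG.gram_posDef hz).det_pos

/-- Raising an index with the inverse of the Gram matrix. -/
theorem IsMetricOn.apply_inv_gram (hG : IsMetricOn G Y) (hz : z ∈ Y) (L : E3 →L[ℝ] ℝ) (c : E3) :
    G z (WithLp.toLp 2 fun k => ∑ l, (gram G z)⁻¹ k l * L (e3 l)) c = L c := by
  refine ext_apply_e3 (fun m => ?_) c
  rw [hG.symm z hz, apply_eq_sum]
  have h1 : gram G z * (gram G z)⁻¹ = 1 :=
    Matrix.mul_nonsing_inv _ (isUnit_iff_ne_zero.2 (hG.det_gram_pos hz).ne')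
  have h2 : (gram G z).mulVec ((gram G z)⁻¹.mulVec fun l => L (e3 l)) = fun l => L (e3 l) := by
    rw [Matrix.mulVec_mulVec, h1, Matrix.one_mulVec]
  have h3 := congrFun h2 m
  simp only [Matrix.mulVec, dotProduct] at h3
  rw [← h3]
  refine Finset.sum_congr rfl fun i _ => ?_
  simp only [gram, Matrix.of_apply]
  ring

theorem IsMetricOn.eq_of_forall_apply_eq (hG : IsMetricOn G Y) (hz : z ∈ Y) {a b : E3}
    (h : ∀ c, G z a c = G z b c) : a = b := by
  by_contra hab
  have := hG.pos z hz (a - b) (sub_ne_zero.2 hab)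
  rw [map_sub] at this
  simp [h] at this

/-! ### The volume form and the vector product -/

theorem detG_add_left (a a' b c : E3) :
    detG G z (a + a') b c = detG G z a b c + detG G z a' b c := by
  simp [detG, Matrix.det_fin_three]; ring

theorem detG_smul_left (r : ℝ) (a b c : E3) : detG G z (r • a) b c = r * detG G z a b c := by
  simp [detG, Matrix.det_fin_three]; ring

theorem detG_add_mid (a b b' c : E3) :
    detG G z a (b + b') c = detG G z a b c + detG G z a b' c := by
  simp [detG, Matrix.det_fin_three]; ring

theorem detG_smul_mid (r : ℝ) (a b c : E3) : detG G z a (r • b) c = r * detG G z a b c := by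
  simp [detG, Matrix.det_fin_three]; ring

theorem detG_add_right (a b c c' : E3) :
    detG G z a b (c + c') = detG G z a b c + detG G z a b c' := by
  simp [detG, Matrix.det_fin_three]; ring

theorem detG_smul_right (r : ℝ) (a b c : E3) : detG G z a b (r • c) = r * detG G z a b c := by
  simp [detG, Matrix.det_fin_three]; ring

theorem detG_rotate (a b c : E3) : detG G z a b c = detG G z b c a := by
  simp [detG, Matrix.det_fin_three]; ring_nf; simp

theorem detG_swap (a b c : E3) : detG G z a b c = - detG G z b a c := by
  simp [detG, Matrix.det_fin_three]; ring

theorem detG_self_left (a c : E3) : detG G z a a c = 0 := by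
  have := detG_swap (G := G) (z := z) a a c
  linarith

theorem detG_self_right (a c : E3) : detG G z a c c = 0 := by
  rw [detG_rotate, detG_self_left]

theorem detG_self_outer (a c : E3) : detG G z a c a = 0 := by
  rw [detG_rotate, detG_self_right]

/-- The linear functional `det_g (a, b, ·)`. -/
def detGLeft (G : E3 → E3 →L[ℝ] E3 →L[ℝ] ℝ) (z a b : E3) : E3 →L[ℝ] ℝ :=
  LinearMap.toContinuousLinearMap
    { toFun := fun c => detG G z a b c
      map_add' := fun c c' => detG_add_right a b c c'
      map_smul' := fun r c => detG_smul_right r a b c }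

theorem IsMetricOn.crossG_apply (hG : IsMetricOn G Y) (hz : z ∈ Y) (a b c : E3) :
    G z (crossG G z a b) c = detG G z a b c :=
  hG.apply_inv_gram hz (detGLeft G z a b) c

/-- Lowering the index of `n` gives a nonzero covector that the matrix with rows `a, b, c` sends to
zero. -/
theorem IsMetricOn.detG_eq_zero_of_orthogonal (hG : IsMetricOn G Y) (hz : z ∈ Y) {a b c n : E3}
    (hn : n ≠ 0) (ha : G z a n = 0) (hb : G z b n = 0) (hc : G z c n = 0) :
    detG G z a b c = 0 := by
  have key : ∀ v : E3, ∑ i, v i * ((gram G z).mulVec n) i = G z v n := fun v => by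
    rw [metric_apply_eq_sum]
    simp [Matrix.mulVec, dotProduct, Finset.mul_sum, mul_assoc]
  have h0 : (gram G z).mulVec n ≠ 0 := fun h => by
    have h1 := hG.pos z hz n hn
    rw [← key] at h1
    simp [h] at h1
  have h2 : !![a 0, a 1, a 2; b 0, b 1, b 2; c 0, c 1, c 2].det = 0 := by
    refine Matrix.exists_mulVec_eq_zero_iff.1 ⟨_, h0, ?_⟩
    have h3 := (key a).trans ha
    have h4 := (key b).trans hb
    have h5 := (key c).trans hc
    rw [Fin.sum_univ_three] at h3 h4 h5
    ext i
    fin_cases i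
    · simpa [Matrix.mulVec, dotProduct, Fin.sum_univ_three] using h3
    · simpa [Matrix.mulVec, dotProduct, Fin.sum_univ_three] using h4
    · simpa [Matrix.mulVec, dotProduct, Fin.sum_univ_three] using h5
  rw [detG, h2, mul_zero]

theorem ne_zero_of_apply_eq_one {n : E3} (hn : G z n n = 1) : n ≠ 0 := by
  rintro rfl
  simp at hn

/-- If `a, b` are orthogonal to the unit vector `n`, then `det_g (a, b, ·)` is proportional to
`⟨n, ·⟩`. -/
theorem IsMetricOn.detG_eq_mul (hG : IsMetricOn G Y) (hz : z ∈ Y) {a b n : E3}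
    (hn : G z n n = 1) (ha : G z a n = 0) (hb : G z b n = 0) (c : E3) :
    detG G z a b c = detG G z a b n * G z c n := by
  have h : detG G z a b (c + (-G z c n) • n) = 0 :=
    hG.detG_eq_zero_of_orthogonal hz (ne_zero_of_apply_eq_one hn) ha hb (by simp [hn])
  rw [detG_add_right, detG_smul_right] at h
  linarith

theorem IsMetricOn.crossG_eq_smul (hG : IsMetricOn G Y) (hz : z ∈ Y) {a b n : E3}
    (hn : G z n n = 1) (ha : G z a n = 0) (hb : G z b n = 0) :
    crossG G z a b = detG G z a b n • n := by
  refine hG.eq_of_forall_apply_eq hz fun c => ?_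
  rw [hG.crossG_apply hz, hG.detG_eq_mul hz hn ha hb, hG.symm z hz c n]
  simp

/-- Turns the denominator `|γ̂' × f_ηη|` of the cuspidal curvature into a determinant with `ν`. -/
theorem IsMetricOn.normG_crossG (hG : IsMetricOn G Y) (hz : z ∈ Y) {a b n : E3}
    (hn : G z n n = 1) (ha : G z a n = 0) (hb : G z b n = 0) :
    normG G z (crossG G z a b) = |detG G z a b n| := by
  rw [hG.crossG_eq_smul hz hn ha hb, normG]
  simp [hn, Real.sqrt_mul_self_eq_abs]

theorem normG_smul (r : ℝ) (a : E3) : normG G z (r • a) = |r| * normG G z a := by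
  simp only [normG, map_smul, smul_eq_mul, smul_apply]
  rw [← mul_assoc, Real.sqrt_mul (mul_self_nonneg r), Real.sqrt_mul_self_eq_abs]

/-- The square of the volume is the Gram determinant. -/
theorem IsMetricOn.detG_sq (hG : IsMetricOn G Y) (hz : z ∈ Y) (a b c : E3) :
    detG G z a b c ^ 2 =
      Matrix.det !![G z a a, G z a b, G z a c; G z b a, G z b b, G z b c;
        G z c a, G z c b, G z c c] := by
  have h : !![G z a a, G z a b, G z a c; G z b a, G z b b, G z b c; G z c a, G z c b, G z c c] =
      !![a 0, a 1, a 2; b 0, b 1, b 2; c 0, c 1, c 2] * gram G z *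
        !![a 0, a 1, a 2; b 0, b 1, b 2; c 0, c 1, c 2].transpose := by
    ext i j
    fin_cases i <;> fin_cases j <;>
      simp [Matrix.mul_apply, Matrix.vecMul, dotProduct, metric_apply_eq_sum,
        Fin.sum_univ_three] <;> ring
  rw [h, Matrix.det_mul, Matrix.det_mul, Matrix.det_transpose, detG, mul_pow,
    Real.sq_sqrt (hG.det_gram_pos hz).le]
  ring

/-- For a unit vector `n` orthogonal to `a`, the vector product `a × n` has the length of `a`. -/
theorem IsMetricOn.crossG_apply_self (hG : IsMetricOn G Y) (hz : z ∈ Y) {a n : E3} (ha : a ≠ 0)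
    (hn : G z n n = 1) (han : G z a n = 0) :
    G z (crossG G z a n) (crossG G z a n) = G z a a := by
  set p := crossG G z a n with hp
  have hpa : G z p a = 0 := by rw [hp, hG.crossG_apply hz, detG_self_outer]
  have hpn : G z p n = 0 := by rw [hp, hG.crossG_apply hz, detG_self_right]
  have hpp : G z p p = detG G z a n p := by rw [← hG.crossG_apply hz]
  -- With `p = a × n`, the Gram determinant of `a, n, p` is `⟨a,a⟩⟨p,p⟩`, and `det_g (a, n, p) =
  -- ⟨p,p⟩`. So `⟨p,p⟩² = ⟨a,a⟩⟨p,p⟩`, and only `p = 0` has to be excluded.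
  have h1 := hG.detG_sq hz a n p
  rw [← hpp, hG.symm z hz n a, hG.symm z hz a p, hG.symm z hz n p, hpa, hpn, han, hn] at h1
  simp only [Matrix.det_fin_three, Matrix.cons_val, Matrix.of_apply, Matrix.cons_val'] at h1
  have h2 : G z p p ≠ 0 := fun h0 => by
    have hp0 : p = 0 := by
      by_contra hne
      exact (hG.pos z hz p hne).ne' h0
    have h3 : ∀ c, detG G z a n c = 0 := fun c => by
      rw [← hG.crossG_apply hz, ← hp, hp0]; simp
    -- a vector orthogonal to `a` and `n`
    obtain ⟨w, hw, hwa, hwn⟩ : ∃ w : E3, w ≠ 0 ∧ G z a w = 0 ∧ G z n w = 0 := by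
      have hlt : Module.finrank ℝ (ℝ × ℝ) < Module.finrank ℝ E3 := by simp
      obtain ⟨w, hw, hw0⟩ := Submodule.exists_mem_ne_zero_of_ne_bot
        (LinearMap.ker_ne_bot_of_finrank_lt
          (f := (((G z a).prod (G z n)) : E3 →L[ℝ] ℝ × ℝ).toLinearMap) hlt)
      have := LinearMap.mem_ker.1 hw
      exact ⟨w, hw0, congrArg Prod.fst this, congrArg Prod.snd this⟩
    have h5 := hG.detG_sq hz a n w
    rw [h3, hG.symm z hz n a, hG.symm z hz w a, hG.symm z hz w n, hwa, hwn, han, hn] at h5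
    simp [Matrix.det_fin_three] at h5
    rcases h5 with h5 | h5
    · exact (hG.pos z hz a ha).ne' h5
    · exact (hG.pos z hz w hw).ne' h5
  have : G z p p * (G z p p - G z a a) = 0 := by linear_combination h1
  rcases mul_eq_zero.1 this with h | h
  · exact absurd h h2
  · linarith

/-- Expansion of a vector orthogonal to the unit vector `n` in the orthogonal frame
`a × n, a`. -/
theorem IsMetricOn.eq_smul_add_smul (hG : IsMetricOn G Y) (hz : z ∈ Y) {a n : E3} (ha : a ≠ 0)
    (hn : G z n n = 1) (han : G z a n = 0) {w : E3} (hwn : G z w n = 0) :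
    w = (detG G z w a n / G z a a) • crossG G z a n + (G z w a / G z a a) • a := by
  have hE := (hG.pos z hz a ha).ne'
  set p := crossG G z a n with hp
  have hpa : G z p a = 0 := by rw [hp, hG.crossG_apply hz, detG_self_outer]
  have hpn : G z p n = 0 := by rw [hp, hG.crossG_apply hz, detG_self_right]
  have hpp : G z p p = G z a a := hG.crossG_apply_self hz ha hn han
  have hpw : G z w p = detG G z w a n := by
    rw [hG.symm z hz, hp, hG.crossG_apply hz, detG_rotate, detG_rotate]
  set r := w + (-((detG G z w a n / G z a a) • p + (G z w a / G z a a) • a)) with hr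
  have hra : G z r a = 0 := by
    simp [hr, hpa]; field_simp; ring
  have hrn : G z r n = 0 := by
    simp [hr, hpn, hwn, han]
  have hrp : G z r p = 0 := by
    simp [hr, hpp, hpw, hG.symm z hz a p, hpa]; field_simp; ring
  -- A nonzero `r` orthogonal to `a`, `n` and `a × n` would force `det_g (a, n, a × n) = 0`, but
  -- this determinant equals `⟨a,a⟩`.
  have h0 : r = 0 := by
    by_contra hne
    have h1 := hG.detG_eq_zero_of_orthogonal hz hne
      ((hG.symm z hz a r).trans hra) ((hG.symm z hz n r).trans hrn) ((hG.symm z hz p r).trans hrp)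
    rw [← hG.crossG_apply hz, ← hp, hpp] at h1
    exact hE h1
  rw [hr] at h0
  exact add_neg_eq_zero.1 h0

end Pointwise

/-! ### Smoothness of the metric operations and the Levi-Civita connection -/

section Calculus

set_option maxSynthPendingDepth 5

variable {G : E3 → E3 →L[ℝ] E3 →L[ℝ] ℝ} {Y : Set E3} {z : E3}
  {X : Type} [NormedAddCommGroup X] [NormedSpace ℝ X]

/-! ### Smoothness of the metric operations -/

theorem contDiffAt_det {n : ℕ} {A : X → Matrix (Fin n) (Fin n) ℝ} {x : X}
    (hA : ∀ i j, ContDiffAt ℝ ∞ (fun w => A w i j) x) : ContDiffAt ℝ ∞ (fun w => (A w).det) x := by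
  simp only [Matrix.det_apply]
  refine ContDiffAt.sum fun σ _ => ?_
  refine ContDiffAt.const_smul _ ?_
  exact contDiffAt_prod fun i _ => hA _ _

theorem contDiffAt_adjugate {n : ℕ} {A : X → Matrix (Fin n) (Fin n) ℝ} {x : X}
    (hA : ∀ i j, ContDiffAt ℝ ∞ (fun w => A w i j) x) (k l : Fin n) :
    ContDiffAt ℝ ∞ (fun w => (A w).adjugate k l) x := by
  simp only [Matrix.adjugate_apply]
  refine contDiffAt_det fun i j => ?_
  by_cases h : i = l
  · subst h; simp only [Matrix.updateRow_self]; exact contDiffAt_const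
  · simp only [Matrix.updateRow_ne h]; exact hA i j

/-- Cramer's rule: the entries of the inverse are entries of the adjugate divided by the
determinant. -/
theorem contDiffAt_inv_matrix {n : ℕ} {A : X → Matrix (Fin n) (Fin n) ℝ} {x : X}
    (hA : ∀ i j, ContDiffAt ℝ ∞ (fun w => A w i j) x) (h0 : (A x).det ≠ 0) (k l : Fin n) :
    ContDiffAt ℝ ∞ (fun w => (A w)⁻¹ k l) x := by
  simp only [Matrix.inv_def, Matrix.smul_apply, smul_eq_mul, Ring.inverse_eq_inv']
  exact ((contDiffAt_det hA).inv h0).mul (contDiffAt_adjugate hA k l)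

variable {c : X → E3} {x : X}

theorem IsMetricOn.contDiffAt_comp (hG : IsMetricOn G Y) (hx : c x ∈ Y)
    (hc : ContDiffAt ℝ ∞ c x) : ContDiffAt ℝ ∞ (fun w => G (c w)) x :=
  (hG.smooth _ hx).comp x hc

theorem IsMetricOn.contDiffAt_apply (hG : IsMetricOn G Y) (hx : c x ∈ Y)
    (hc : ContDiffAt ℝ ∞ c x) {V W : X → E3} (hV : ContDiffAt ℝ ∞ V x)
    (hW : ContDiffAt ℝ ∞ W x) : ContDiffAt ℝ ∞ (fun w => G (c w) (V w) (W w)) x :=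
  ((hG.contDiffAt_comp hx hc).clm_apply hV).clm_apply hW

theorem IsMetricOn.contDiffAt_gram (hG : IsMetricOn G Y) (hx : c x ∈ Y)
    (hc : ContDiffAt ℝ ∞ c x) (i j : Fin 3) : ContDiffAt ℝ ∞ (fun w => gram G (c w) i j) x :=
  hG.contDiffAt_apply hx hc contDiffAt_const contDiffAt_const

theorem contDiffAt_coord {V : X → E3} (hV : ContDiffAt ℝ ∞ V x) (i : Fin 3) :
    ContDiffAt ℝ ∞ (fun w => V w i) x :=
  (contDiffAt_euclidean.1 hV) i

theorem IsMetricOn.contDiffAt_detG (hG : IsMetricOn G Y) (hx : c x ∈ Y)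
    (hc : ContDiffAt ℝ ∞ c x) {U V W : X → E3} (hU : ContDiffAt ℝ ∞ U x)
    (hV : ContDiffAt ℝ ∞ V x) (hW : ContDiffAt ℝ ∞ W x) :
    ContDiffAt ℝ ∞ (fun w => detG G (c w) (U w) (V w) (W w)) x := by
  refine ContDiffAt.mul ?_ (contDiffAt_det fun i j => ?_)
  · exact (contDiffAt_det (hG.contDiffAt_gram hx hc)).sqrt (hG.det_gram_pos hx).ne'
  · fin_cases i <;> fin_cases j <;> simp <;>
      first
      | exact contDiffAt_coord hU _
      | exact contDiffAt_coord hV _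
      | exact contDiffAt_coord hW _

theorem IsMetricOn.contDiffAt_raise (hG : IsMetricOn G Y) (hx : c x ∈ Y)
    (hc : ContDiffAt ℝ ∞ c x) {T : Fin 3 → X → ℝ} (hT : ∀ l, ContDiffAt ℝ ∞ (T l) x) (r : ℝ) :
    ContDiffAt ℝ ∞ (fun w => (WithLp.toLp 2 fun k =>
      r * ∑ l, (gram G (c w))⁻¹ k l * T l w : E3)) x := by
  refine contDiffAt_euclidean.2 fun k => ?_
  refine contDiffAt_const.mul (ContDiffAt.sum fun l _ => ContDiffAt.mul ?_ (hT l))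
  exact contDiffAt_inv_matrix (hG.contDiffAt_gram hx hc) (hG.det_gram_pos hx).ne' k l

theorem IsMetricOn.contDiffAt_crossG (hG : IsMetricOn G Y) (hx : c x ∈ Y)
    (hc : ContDiffAt ℝ ∞ c x) {U V : X → E3} (hU : ContDiffAt ℝ ∞ U x)
    (hV : ContDiffAt ℝ ∞ V x) : ContDiffAt ℝ ∞ (fun w => crossG G (c w) (U w) (V w)) x := by
  have h := hG.contDiffAt_raise hx hc
    (fun l => hG.contDiffAt_detG hx hc hU hV (contDiffAt_const (c := e3 l))) 1
  simp only [one_mul] at h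
  exact h

theorem IsMetricOn.contDiffAt_christoffel (hG : IsMetricOn G Y) (hx : c x ∈ Y)
    (hc : ContDiffAt ℝ ∞ c x) {U V : X → E3} (hU : ContDiffAt ℝ ∞ U x)
    (hV : ContDiffAt ℝ ∞ V x) : ContDiffAt ℝ ∞ (fun w => christoffel G (c w) (U w) (V w)) x := by
  refine hG.contDiffAt_raise hx hc (fun l => ?_) (1 / 2)
  have hD : ContDiffAt ℝ ∞ (fun w => fderiv ℝ G (c w)) x :=
    ((hG.smooth _ hx).fderiv_right (m := ∞) (by simp)).comp x hc
  have he : ContDiffAt ℝ ∞ (fun _ : X => e3 l) x := contDiffAt_const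
  exact ((((hD.clm_apply hU).clm_apply hV).clm_apply he).add
    (((hD.clm_apply hV).clm_apply hU).clm_apply he)).sub
    (((hD.clm_apply he).clm_apply hU).clm_apply hV)

theorem contDiffAt_fderiv_apply {V : X → E3} {W : X → X} (hV : ContDiffAt ℝ ∞ V x)
    (hW : ContDiffAt ℝ ∞ W x) : ContDiffAt ℝ ∞ (fun w => fderiv ℝ V w (W w)) x :=
  (hV.fderiv_right (m := ∞) (by simp)).clm_apply hW

theorem IsMetricOn.contDiffAt_covD (hG : IsMetricOn G Y) (hx : c x ∈ Y)
    (hc : ContDiffAt ℝ ∞ c x) {V : X → E3} {W : X → X} (hV : ContDiffAt ℝ ∞ V x)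
    (hW : ContDiffAt ℝ ∞ W x) : ContDiffAt ℝ ∞ (fun w => covD G c V w (W w)) x :=
  (contDiffAt_fderiv_apply hV hW).add
    (hG.contDiffAt_christoffel hx hc (contDiffAt_fderiv_apply hc hW) hV)

/-! ### The Levi-Civita connection -/

theorem christoffel_add_left (a a' b : E3) :
    christoffel G z (a + a') b = christoffel G z a b + christoffel G z a' b := by
  ext k
  simp [christoffel, Fin.sum_univ_three]
  ring

theorem christoffel_smul_left (r : ℝ) (a b : E3) :
    christoffel G z (r • a) b = r • christoffel G z a b := by
  ext k
  simp [christoffel, Fin.sum_univ_three]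
  ring

theorem christoffel_add_right (a b b' : E3) :
    christoffel G z a (b + b') = christoffel G z a b + christoffel G z a b' := by
  ext k
  simp [christoffel, Fin.sum_univ_three]
  ring

theorem christoffel_smul_right (r : ℝ) (a b : E3) :
    christoffel G z a (r • b) = r • christoffel G z a b := by
  ext k
  simp [christoffel, Fin.sum_univ_three]
  ring

theorem IsMetricOn.fderiv_symm (hG : IsMetricOn G Y) (hz : z ∈ Y) (w a b : E3) :
    fderiv ℝ G z w a b = fderiv ℝ G z w b a := by
  have hd : DifferentiableAt ℝ G z := (hG.smooth z hz).differentiableAt (by simp)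
  have h1 : ∀ a b : E3, fderiv ℝ (fun z => G z a b) z w = fderiv ℝ G z w a b := fun a b => by
    have := ((hd.hasFDerivAt.clm_apply (hasFDerivAt_const a z)).clm_apply
      (hasFDerivAt_const b z)).fderiv
    rw [this]; simp
  rw [← h1, ← h1]
  congr 1
  refine Filter.EventuallyEq.fderiv_eq ?_
  filter_upwards [hG.isOpen.mem_nhds hz] with y hy using hG.symm y hy a b

theorem IsMetricOn.christoffel_comm (hG : IsMetricOn G Y) (hz : z ∈ Y) (a b : E3) :
    christoffel G z a b = christoffel G z b a := by
  ext k
  simp only [christoffel]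
  congr 1
  refine Finset.sum_congr rfl fun l _ => ?_
  rw [hG.fderiv_symm hz (e3 l) a b, add_comm (fderiv ℝ G z a b (e3 l))]

/-- The Koszul formula. -/
theorem IsMetricOn.apply_christoffel (hG : IsMetricOn G Y) (hz : z ∈ Y) (a b c : E3) :
    G z (christoffel G z a b) c =
      1 / 2 * (fderiv ℝ G z a b c + fderiv ℝ G z b a c - fderiv ℝ G z c a b) := by
  -- `L` is the Koszul expression as a functional of `c`; the two flips move `c` into the
  -- differentiation slot of the third term. The Christoffel vector is half of `L` with its index
  -- raised.
  set L : E3 →L[ℝ] ℝ := (fderiv ℝ G z a b + fderiv ℝ G z b a - ((fderiv ℝ G z).flip a).flip b)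
    with hL
  have h := hG.apply_inv_gram hz L c
  have h2 : christoffel G z a b =
      (1 / 2 : ℝ) • (WithLp.toLp 2 fun k => ∑ l, (gram G z)⁻¹ k l * L (e3 l) : E3) := by
    ext k
    simp [christoffel, hL]
  rw [h2, map_smul, smul_apply, h]
  simp [hL]

variable {V W : X → E3} {w : X}

theorem covD_congr {V' : X → E3} (h : V =ᶠ[𝓝 x] V') : covD G c V x w = covD G c V' x w := by
  rw [covD, covD, h.fderiv_eq, h.eq_of_nhds]

theorem covD_add (hV : DifferentiableAt ℝ V x) (hW : DifferentiableAt ℝ W x) :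
    covD G c (fun y => V y + W y) x w = covD G c V x w + covD G c W x w := by
  rw [covD, covD, covD, fderiv_fun_add hV hW, christoffel_add_right]
  simp only [add_apply]
  abel

theorem covD_smul {s : X → ℝ} (hs : DifferentiableAt ℝ s x) (hV : DifferentiableAt ℝ V x) :
    covD G c (fun y => s y • V y) x w = fderiv ℝ s x w • V x + s x • covD G c V x w := by
  rw [covD, covD, fderiv_fun_smul hs hV, christoffel_smul_right]
  simp only [add_apply, smul_apply, ContinuousLinearMap.smulRight_apply, smul_add]
  abel

theorem covD_add_dir (w w' : X) : covD G c V x (w + w') = covD G c V x w + covD G c V x w' := by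
  rw [covD, covD, covD, map_add, map_add, christoffel_add_left]
  abel

theorem covD_smul_dir (r : ℝ) (w : X) : covD G c V x (r • w) = r • covD G c V x w := by
  rw [covD, covD, map_smul, map_smul, christoffel_smul_left, smul_add]

/-- Compatibility of the connection with the metric. -/
theorem IsMetricOn.fderiv_apply (hG : IsMetricOn G Y) (hx : c x ∈ Y)
    (hc : DifferentiableAt ℝ c x) (hV : DifferentiableAt ℝ V x) (hW : DifferentiableAt ℝ W x) :
    fderiv ℝ (fun y => G (c y) (V y) (W y)) x w =
      G (c x) (covD G c V x w) (W x) + G (c x) (V x) (covD G c W x w) := by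
  have hd : DifferentiableAt ℝ G (c x) := (hG.smooth _ hx).differentiableAt (by simp)
  have h0 : HasFDerivAt (fun y => G (c y)) ((fderiv ℝ G (c x)).comp (fderiv ℝ c x)) x :=
    hd.hasFDerivAt.comp x hc.hasFDerivAt
  have h := ((h0.clm_apply hV.hasFDerivAt).clm_apply hW.hasFDerivAt).fderiv
  have h' : fderiv ℝ (fun y => G (c y) (V y) (W y)) x w =
      fderiv ℝ G (c x) (fderiv ℝ c x w) (V x) (W x) + G (c x) (fderiv ℝ V x w) (W x)
        + G (c x) (V x) (fderiv ℝ W x w) := by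
    have h2 := congrArg (fun L : X →L[ℝ] ℝ => L w) h
    simp only at h2
    rw [h2]
    simp
    ring
  -- In the sum of the two Koszul formulas the terms antisymmetric in `V, W` cancel, and the
  -- derivative of the metric along `c` remains.
  rw [h', covD, covD, map_add, map_add, add_apply, hG.symm _ hx (V x) (christoffel _ _ _ _),
    hG.apply_christoffel hx, hG.apply_christoffel hx,
    hG.fderiv_symm hx (fderiv ℝ c x w) (W x) (V x)]
  ring

/-- The connection is torsion free. -/
theorem IsMetricOn.covD_pd_comm (hG : IsMetricOn G Y) {F : E2 → E3} {x : E2} (hx : F x ∈ Y)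
    (hF : ContDiffAt ℝ ∞ F x) (i j : Fin 2) :
    covD G F (pd F i) x (e2 j) = covD G F (pd F j) x (e2 i) := by
  have hd : DifferentiableAt ℝ (fderiv ℝ F) x :=
    (hF.fderiv_right (m := ∞) (by simp)).differentiableAt (by simp)
  have h1 : ∀ i j : Fin 2, fderiv ℝ (pd F i) x (e2 j) = fderiv ℝ (fderiv ℝ F) x (e2 j) (e2 i) :=
    fun i j => by
      have := (hd.hasFDerivAt.clm_apply (hasFDerivAt_const (e2 i) x)).fderiv
      have h2 : fderiv ℝ (pd F i) x = _ := this
      rw [h2]; simp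
  have hs : IsSymmSndFDerivAt ℝ F x := hF.isSymmSndFDerivAt (by
    rw [minSmoothness_of_isRCLikeNormedField]
    exact WithTop.coe_le_coe.2 le_top)
  rw [covD, covD, h1, h1, hs.eq (e2 j) (e2 i)]
  congr 1
  exact hG.christoffel_comm hx _ _

end Calculus

/-! ### The frame `f_v × ν, f_v` and the mean curvature of a frontal in adapted coordinates -/

section AdaptedFrontal

variable {G : E3 → E3 →L[ℝ] E3 →L[ℝ] ℝ} {Y : Set E3} {F N : E2 → E3} {V : Set E2} {z : E2}

/-- A frontal with unit normal field `N` on the open set `V` of the coordinate plane, in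
coordinates for which `f_v ≠ 0`, the points of the `u`-axis are singular and `λ_v ≠ 0`. -/
structure IsAdaptedFrontal (G : E3 → E3 →L[ℝ] E3 →L[ℝ] ℝ) (Y : Set E3) (F N : E2 → E3)
    (V : Set E2) : Prop where
  metric : IsMetricOn G Y
  isOpen : IsOpen V
  mapsTo : ∀ z ∈ V, F z ∈ Y
  smooth : ∀ z ∈ V, ContDiffAt ℝ ∞ F z
  smooth_normal : ∀ z ∈ V, ContDiffAt ℝ ∞ N z
  unit : ∀ z ∈ V, G (F z) (N z) (N z) = 1
  normal : ∀ z ∈ V, ∀ w, G (F z) (fderiv ℝ F z w) (N z) = 0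
  pd_ne_zero : ∀ z ∈ V, pd F 1 z ≠ 0
  lam_eq_zero : ∀ z ∈ V, z 1 = 0 → lam G F N z = 0
  fderiv_lam_ne_zero : ∀ z ∈ V, fderiv ℝ (lam G F N) z (e2 1) ≠ 0

/-- The vector field `f_v × ν`. -/
def conormal (G : E3 → E3 →L[ℝ] E3 →L[ℝ] ℝ) (F N : E2 → E3) (z : E2) : E3 :=
  crossG G (F z) (pd F 1 z) (N z)

/-- The coefficient of `f_v` in the expansion of `f_u` in the frame `f_v × ν, f_v`. -/
def slope (G : E3 → E3 →L[ℝ] E3 →L[ℝ] ℝ) (F : E2 → E3) (z : E2) : ℝ :=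
  firstFF G F 0 1 z / firstFF G F 1 1 z

/-- The coefficient of `f_v × ν` in the expansion of `f_u` in the frame `f_v × ν, f_v`. -/
def height (G : E3 → E3 →L[ℝ] E3 →L[ℝ] ℝ) (F N : E2 → E3) (z : E2) : ℝ :=
  lam G F N z / firstFF G F 1 1 z

/-- The coefficients `⟨f_v × ν, ∇_i ν⟩`. -/
def conormalFF (G : E3 → E3 →L[ℝ] E3 →L[ℝ] ℝ) (F N : E2 → E3) (i : Fin 2) (z : E2) : ℝ :=
  G (F z) (conormal G F N z) (covD G F N z (e2 i))

theorem contDiffAt_pd (hF : ContDiffAt ℝ ∞ F z) (i : Fin 2) : ContDiffAt ℝ ∞ (pd F i) z :=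
  contDiffAt_fderiv_apply hF contDiffAt_const

theorem eq_smul_e2_add (w : E2) : w = w 0 • e2 0 + w 1 • e2 1 := by
  ext j
  fin_cases j <;> simp [e2]

theorem fderiv_eq_smul_pd_add (F : E2 → E3) (z w : E2) :
    fderiv ℝ F z w = w 0 • pd F 0 z + w 1 • pd F 1 z := by
  conv_lhs => rw [eq_smul_e2_add w]
  rw [map_add, map_smul, map_smul, pd, pd]

/-- The differential of a function that vanishes on the `u`-axis. -/
theorem fderiv_eq_of_eq_zero_on_axis {L : E2 → ℝ} (hL : DifferentiableAt ℝ L z)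
    (h0 : ∀ᶠ y in 𝓝 z, y 1 = 0 → L y = 0) (hz1 : z 1 = 0) (w : E2) :
    fderiv ℝ L z w = w 1 * fderiv ℝ L z (e2 1) := by
  have h1 : fderiv ℝ L z (e2 0) = 0 := by
    have hline : HasDerivAt (fun s : ℝ => z + s • e2 0) (e2 0) 0 := by
      simpa using ((hasDerivAt_id (0 : ℝ)).smul_const (e2 0)).const_add z
    have hz' : z + (0 : ℝ) • e2 0 = z := by simp
    have h2 : HasDerivAt (fun s : ℝ => L (z + s • e2 0)) (fderiv ℝ L z (e2 0)) 0 :=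
      HasFDerivAt.comp_hasDerivAt_of_eq (0 : ℝ) hL.hasFDerivAt hline hz'.symm
    have h3 : (fun s : ℝ => L (z + s • e2 0)) =ᶠ[𝓝 0] fun _ => 0 := by
      have hcont : Tendsto (fun s : ℝ => z + s • e2 0) (𝓝 0) (𝓝 z) := by
        have := hline.continuousAt.tendsto
        rwa [hz'] at this
      filter_upwards [hcont.eventually h0] with s hs
      exact hs (by simp [hz1, e2])
    exact h2.unique ((hasDerivAt_const (0 : ℝ) (0 : ℝ)).congr_of_eventuallyEq h3)
  conv_lhs => rw [eq_smul_e2_add w]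
  rw [map_add, map_smul, map_smul, h1]
  simp

namespace IsAdaptedFrontal

variable (h : IsAdaptedFrontal G Y F N V) (hz : z ∈ V)

include h hz

theorem normal_pd (i : Fin 2) : G (F z) (pd F i z) (N z) = 0 := h.normal z hz _

theorem firstFF_pos : 0 < firstFF G F 1 1 z :=
  h.metric.pos _ (h.mapsTo z hz) _ (h.pd_ne_zero z hz)

theorem conormal_apply (w : E3) :
    G (F z) (conormal G F N z) w = detG G (F z) (pd F 1 z) (N z) w :=
  h.metric.crossG_apply (h.mapsTo z hz) _ _ _

theorem conormal_pd : G (F z) (conormal G F N z) (pd F 1 z) = 0 := by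
  rw [h.conormal_apply hz, detG_self_outer]

theorem conormal_normal : G (F z) (conormal G F N z) (N z) = 0 := by
  rw [h.conormal_apply hz, detG_self_right]

theorem conormal_self :
    G (F z) (conormal G F N z) (conormal G F N z) = firstFF G F 1 1 z :=
  h.metric.crossG_apply_self (h.mapsTo z hz) (h.pd_ne_zero z hz) (h.unit z hz) (h.normal_pd hz 1)

/-- This is `f_v × (f_v × ν) = -|f_v|² ν`, paired with `w`. -/
theorem detG_pd_conormal (w : E3) :
    detG G (F z) (pd F 1 z) (conormal G F N z) w = - firstFF G F 1 1 z * G (F z) w (N z) := by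
  rw [h.metric.detG_eq_mul (h.mapsTo z hz) (h.unit z hz) (h.normal_pd hz 1)
    (h.conormal_normal hz), detG_rotate, detG_swap, ← detG_rotate, ← h.conormal_apply hz,
    h.conormal_self hz]

theorem pd_zero_eq :
    pd F 0 z = height G F N z • conormal G F N z + slope G F z • pd F 1 z :=
  h.metric.eq_smul_add_smul (h.mapsTo z hz) (h.pd_ne_zero z hz) (h.unit z hz) (h.normal_pd hz 1)
    (h.normal_pd hz 0)

theorem contDiffAt_conormal : ContDiffAt ℝ ∞ (conormal G F N) z :=
  h.metric.contDiffAt_crossG (h.mapsTo z hz) (h.smooth z hz) (contDiffAt_pd (h.smooth z hz) 1)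
    (h.smooth_normal z hz)

theorem contDiffAt_firstFF (i j : Fin 2) : ContDiffAt ℝ ∞ (firstFF G F i j) z :=
  h.metric.contDiffAt_apply (h.mapsTo z hz) (h.smooth z hz) (contDiffAt_pd (h.smooth z hz) i)
    (contDiffAt_pd (h.smooth z hz) j)

theorem contDiffAt_lam : ContDiffAt ℝ ∞ (lam G F N) z :=
  h.metric.contDiffAt_detG (h.mapsTo z hz) (h.smooth z hz) (contDiffAt_pd (h.smooth z hz) 0)
    (contDiffAt_pd (h.smooth z hz) 1) (h.smooth_normal z hz)

theorem contDiffAt_slope : ContDiffAt ℝ ∞ (slope G F) z :=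
  (h.contDiffAt_firstFF hz 0 1).div (h.contDiffAt_firstFF hz 1 1) (h.firstFF_pos hz).ne'

theorem contDiffAt_height : ContDiffAt ℝ ∞ (height G F N) z :=
  (h.contDiffAt_lam hz).div (h.contDiffAt_firstFF hz 1 1) (h.firstFF_pos hz).ne'

theorem contDiffAt_covD {W : E2 → E3} (hW : ContDiffAt ℝ ∞ W z) {w : E2 → E2}
    (hw : ContDiffAt ℝ ∞ w z) : ContDiffAt ℝ ∞ (fun y => covD G F W y (w y)) z :=
  h.metric.contDiffAt_covD (h.mapsTo z hz) (h.smooth z hz) hW hw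

theorem contDiffAt_conormalFF (i : Fin 2) : ContDiffAt ℝ ∞ (conormalFF G F N i) z :=
  h.metric.contDiffAt_apply (h.mapsTo z hz) (h.smooth z hz) (h.contDiffAt_conormal hz)
    (h.contDiffAt_covD hz (h.smooth_normal z hz) contDiffAt_const)

theorem contDiffAt_secondFF (i j : Fin 2) : ContDiffAt ℝ ∞ (secondFF G F N i j) z :=
  (h.metric.contDiffAt_apply (h.mapsTo z hz) (h.smooth z hz) (contDiffAt_pd (h.smooth z hz) i)
    (h.contDiffAt_covD hz (h.smooth_normal z hz) contDiffAt_const)).neg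

theorem eventually_mem : ∀ᶠ y in 𝓝 z, y ∈ V := h.isOpen.mem_nhds hz

/-- If `W` is orthogonal to the normal field, then `⟨∇_w W, ν⟩ = - ⟨W, ∇_w ν⟩`. -/
theorem covD_apply_normal {W : E2 → E3} (hW : ContDiffAt ℝ ∞ W z)
    (hWN : ∀ y ∈ V, G (F y) (W y) (N y) = 0) (w : E2) :
    G (F z) (covD G F W z w) (N z) = - G (F z) (W z) (covD G F N z w) := by
  have h1 := h.metric.fderiv_apply (w := w) (h.mapsTo z hz)
    ((h.smooth z hz).differentiableAt (by simp)) (hW.differentiableAt (by simp))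
    ((h.smooth_normal z hz).differentiableAt (by simp))
  have h2 : (fun y => G (F y) (W y) (N y)) =ᶠ[𝓝 z] fun _ => 0 := by
    filter_upwards [h.eventually_mem hz] with y hy using hWN y hy
  rw [h2.fderiv_eq, fderiv_fun_const] at h1
  simp only [Pi.zero_apply, zero_apply] at h1
  linarith

theorem secondFF_eq (i j : Fin 2) :
    secondFF G F N i j z = G (F z) (covD G F (pd F i) z (e2 j)) (N z) := by
  rw [h.covD_apply_normal hz (contDiffAt_pd (h.smooth z hz) i) fun y hy => h.normal_pd hy i,
    secondFF]

/-- Symmetry comes from the torsion-free identity `∇_v f_u = ∇_u f_v`, once the derivative is moved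
from `ν` to `f_i`. -/
theorem secondFF_comm : secondFF G F N 0 1 z = secondFF G F N 1 0 z := by
  rw [h.secondFF_eq hz, h.secondFF_eq hz, h.metric.covD_pd_comm (h.mapsTo z hz) (h.smooth z hz)]

theorem secondFF_zero (i : Fin 2) :
    secondFF G F N 0 i z =
      - height G F N z * conormalFF G F N i z + slope G F z * secondFF G F N 1 i z := by
  simp only [secondFF, conormalFF]
  rw [h.pd_zero_eq hz]
  simp
  ring

theorem firstFF_zero_one : firstFF G F 0 1 z = slope G F z * firstFF G F 1 1 z := by
  rw [slope, div_mul_cancel₀ _ (h.firstFF_pos hz).ne']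

theorem firstFF_zero_zero :
    firstFF G F 0 0 z = (height G F N z ^ 2 + slope G F z ^ 2) * firstFF G F 1 1 z := by
  have h1 := h.conormal_self hz
  have h2 := h.conormal_pd hz
  have h3 : G (F z) (pd F 1 z) (conormal G F N z) = 0 :=
    (h.metric.symm _ (h.mapsTo z hz) _ _).trans h2
  simp only [firstFF] at h1 ⊢
  rw [h.pd_zero_eq hz]
  simp only [map_add, map_smul, add_apply, smul_apply, smul_eq_mul, h1, h2, h3]
  ring

/-- Inserting `f_u = h (f_v × ν) + s f_v` makes the first fundamental determinant equal to `λ²`. The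
part of the numerator free of `h` cancels by symmetry of the second fundamental form, so a single
`λ` survives below and the bracket is smooth across the singular set. -/
theorem meanCurvature_eq (hθ : lam G F N z ≠ 0) :
    2 * (z 1 * meanCurvature G F N z) = z 1 / lam G F N z *
      (height G F N z * secondFF G F N 1 1 z + slope G F z * conormalFF G F N 1 z
        - conormalFF G F N 0 z) := by
  have hE := (h.firstFF_pos hz).ne'
  have hht : height G F N z ≠ 0 := div_ne_zero hθ hE
  have hlam : lam G F N z = height G F N z * firstFF G F 1 1 z := by
    rw [height, div_mul_cancel₀ _ hE]
  rw [hlam, meanCurvature, h.firstFF_zero_zero hz, h.firstFF_zero_one hz, h.secondFF_zero hz 0,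
    ← h.secondFF_comm hz, h.secondFF_zero hz 1]
  have hden : 2 * ((height G F N z ^ 2 + slope G F z ^ 2) * firstFF G F 1 1 z * firstFF G F 1 1 z
      - (slope G F z * firstFF G F 1 1 z) ^ 2) =
      2 * (height G F N z * firstFF G F 1 1 z) ^ 2 := by ring
  rw [hden]
  field_simp
  ring

theorem height_eq_zero (hz1 : z 1 = 0) : height G F N z = 0 := by
  rw [height, h.lam_eq_zero z hz hz1, zero_div]

theorem pd_zero_eq_smul (hz1 : z 1 = 0) : pd F 0 z = slope G F z • pd F 1 z := by
  rw [h.pd_zero_eq hz, h.height_eq_zero hz hz1, zero_smul, zero_add]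

theorem fderiv_lam_eq (hz1 : z 1 = 0) (w : E2) :
    fderiv ℝ (lam G F N) z w = w 1 * fderiv ℝ (lam G F N) z (e2 1) := by
  refine fderiv_eq_of_eq_zero_on_axis ((h.contDiffAt_lam hz).differentiableAt (by simp)) ?_ hz1 w
  filter_upwards [h.eventually_mem hz] with y hy using h.lam_eq_zero y hy

/-- Differentiate `h |f_v|² = λ`; the derivative of `|f_v|²` drops out because `h = 0` on the axis.
-/
theorem fderiv_height_eq (hz1 : z 1 = 0) (w : E2) :
    fderiv ℝ (height G F N) z w =
      w 1 * (fderiv ℝ (lam G F N) z (e2 1) / firstFF G F 1 1 z) := by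
  have hE := (h.firstFF_pos hz).ne'
  have h1 : fderiv ℝ (fun y => height G F N y * firstFF G F 1 1 y) z w =
      fderiv ℝ (height G F N) z w * firstFF G F 1 1 z := by
    rw [fderiv_fun_mul ((h.contDiffAt_height hz).differentiableAt (by simp))
      ((h.contDiffAt_firstFF hz 1 1).differentiableAt (by simp)), h.height_eq_zero hz hz1]
    simp [mul_comm]
  have h2 : (fun y => height G F N y * firstFF G F 1 1 y) =ᶠ[𝓝 z] lam G F N := by
    filter_upwards [h.eventually_mem hz] with y hy
    rw [height, div_mul_cancel₀ _ (h.firstFF_pos hy).ne']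
  rw [h2.fderiv_eq, h.fderiv_lam_eq hz hz1] at h1
  field_simp
  linarith

end IsAdaptedFrontal

end AdaptedFrontal

/-! ### Singular, normal and cuspidal curvature along the singular curve -/

section CurveInvariants

variable {G : E3 → E3 →L[ℝ] E3 →L[ℝ] ℝ} {Y : Set E3} {F N : E2 → E3} {V : Set E2} {z : E2}

theorem covD_comp {W : E2 → E3} {c : ℝ → E2} {t : ℝ} (hF : DifferentiableAt ℝ F (c t))
    (hW : DifferentiableAt ℝ W (c t)) (hc : DifferentiableAt ℝ c t) :
    covD G (F ∘ c) (W ∘ c) t 1 = covD G F W (c t) (deriv c t) := by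
  rw [covD, covD, fderiv_comp t hF hc, fderiv_comp t hW hc]
  simp

theorem covD_smul_add_smul {X : Type} [NormedAddCommGroup X] [NormedSpace ℝ X] {c : X → E3}
    {m n : X → ℝ} {A B : X → E3} {x : X} (hm : DifferentiableAt ℝ m x)
    (hA : DifferentiableAt ℝ A x) (hn : DifferentiableAt ℝ n x) (hB : DifferentiableAt ℝ B x)
    (w : X) :
    covD G c (fun y => m y • A y + n y • B y) x w =
      (fderiv ℝ m x w • A x + m x • covD G c A x w) +
        (fderiv ℝ n x w • B x + n x • covD G c B x w) := by
  rw [covD_add (hm.fun_smul hA) (hn.fun_smul hB), covD_smul hm hA, covD_smul hn hB]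

/-- The coefficient of `f_v` in the velocity of a curve in the `u`-axis. -/
def speed (G : E3 → E3 →L[ℝ] E3 →L[ℝ] ℝ) (F : E2 → E3) (c : ℝ → E2) (t : ℝ) : ℝ :=
  deriv c t 0 * slope G F (c t)

theorem deriv_coord_eq_zero {c : ℝ → E2} {t : ℝ} (hc : DifferentiableAt ℝ c t)
    (hax : ∀ᶠ s in 𝓝 t, c s 1 = 0) : deriv c t 1 = 0 := by
  have h1 : HasDerivAt (fun s => c s 1) (deriv c t 1) t :=
    ((EuclideanSpace.proj (𝕜 := ℝ) (1 : Fin 2)).hasFDerivAt.comp_hasDerivAt t hc.hasDerivAt)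
  exact h1.unique ((hasDerivAt_const t (0 : ℝ)).congr_of_eventuallyEq hax)

namespace IsAdaptedFrontal

theorem normG_pd_sq (h : IsAdaptedFrontal G Y F N V) (hz : z ∈ V) :
    normG G (F z) (pd F 1 z) ^ 2 = firstFF G F 1 1 z :=
  Real.sq_sqrt (h.firstFF_pos hz).le

theorem normG_pd_pos (h : IsAdaptedFrontal G Y F N V) (hz : z ∈ V) :
    0 < normG G (F z) (pd F 1 z) :=
  Real.sqrt_pos.2 (h.firstFF_pos hz)

variable {c : ℝ → E2} {t : ℝ} (h : IsAdaptedFrontal G Y F N V) (hct : c t ∈ V)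
  (hc : ContDiffAt ℝ ∞ c t) (hax : ∀ᶠ s in 𝓝 t, c s 1 = 0)

include h hct hc hax

theorem eventually_differentiableAt :
    ∀ᶠ s in 𝓝 t, c s ∈ V ∧ DifferentiableAt ℝ c s ∧ ∀ᶠ r in 𝓝 s, c r 1 = 0 := by
  have h1 : ∀ᶠ s in 𝓝 t, ContDiffAt ℝ 1 c s :=
    (hc.of_le (by simp : (1 : WithTop ℕ∞) ≤ ∞)).eventually (by simp)
  filter_upwards [hc.continuousAt.eventually (h.eventually_mem hct), h1,
    eventually_eventually_nhds.2 hax] with s h2 h3 h4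
  exact ⟨h2, h3.differentiableAt (by simp), h4⟩

theorem vel_eventuallyEq : vel F c =ᶠ[𝓝 t] fun s => speed G F c s • pd F 1 (c s) := by
  filter_upwards [h.eventually_differentiableAt hct hc hax] with s hs
  obtain ⟨hV, hd, hs⟩ := hs
  have h1 : vel F c s = fderiv ℝ F (c s) (deriv c s) := by
    rw [vel]
    exact (((h.smooth _ hV).differentiableAt (by simp)).hasFDerivAt.comp_hasDerivAt s
      hd.hasDerivAt).deriv
  rw [h1, fderiv_eq_smul_pd_add, deriv_coord_eq_zero hd hs, zero_smul, add_zero,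
    h.pd_zero_eq_smul hV hs.self_of_nhds, smul_smul, speed]

theorem vel_eq : vel F c t = speed G F c t • pd F 1 (c t) :=
  (h.vel_eventuallyEq hct hc hax).self_of_nhds

/-- The velocity is `speed • f_v` along the axis, so the Leibniz rule produces `∇_u f_v`;
torsion-freeness rewrites it as `∇_v f_u`, the vector that also governs `λ_v` at `p`. -/
theorem acc_eq : acc G F c t = deriv (speed G F c) t • pd F 1 (c t) +
    (speed G F c t * deriv c t 0) • covD G F (pd F 0) (c t) (e2 1) := by
  have hd : DifferentiableAt ℝ c t := hc.differentiableAt (by simp)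
  have hpd : ContDiffAt ℝ ∞ (pd F 1) (c t) := contDiffAt_pd (h.smooth _ hct) 1
  have hdc : ContDiffAt ℝ ∞ (deriv c) t := by
    have h1 : ContDiffAt ℝ ∞ (fun s => fderiv ℝ c s 1) t :=
      (hc.fderiv_right (m := ∞) (by simp)).clm_apply contDiffAt_const
    exact h1
  have hs : ContDiffAt ℝ ∞ (speed G F c) t :=
    ((contDiffAt_euclidean.1 hdc) 0).mul ((h.contDiffAt_slope hct).comp t hc)
  rw [acc, covD_congr (h.vel_eventuallyEq hct hc hax),
    covD_smul (V := fun s => pd F 1 (c s)) (hs.differentiableAt (by simp))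
      ((hpd.comp t hc).differentiableAt (by simp))]
  have h2 := covD_comp (G := G) ((h.smooth _ hct).differentiableAt (by simp))
    (hpd.differentiableAt (by simp)) hd
  rw [show (fun s => pd F 1 (c s)) = pd F 1 ∘ c from rfl, h2, eq_smul_e2_add (deriv c t),
    deriv_coord_eq_zero hd hax, zero_smul, add_zero, covD_smul_dir,
    h.metric.covD_pd_comm (h.mapsTo _ hct) (h.smooth _ hct) 1 0, smul_smul]
  simp [e2]

theorem detG_vel_acc : detG G (F (c t)) (vel F c t) (acc G F c t) (N (c t)) =
    - (speed G F c t ^ 2 * deriv c t 0 *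
      G (F (c t)) (conormal G F N (c t)) (covD G F (pd F 0) (c t) (e2 1))) := by
  rw [h.vel_eq hct hc hax, h.acc_eq hct hc hax, detG_smul_left, detG_add_mid, detG_smul_mid,
    detG_self_left, detG_smul_mid, h.conormal_apply hct,
    detG_rotate (pd F 1 (c t)) (N (c t)), detG_rotate (N (c t)), detG_swap]
  ring

/-- The determinant is quadratic in the speed and linear in `u'`, while `|γ̂'|³` is cubic in the
speed `u' s`. One factor `s` is therefore left in the denominator, and it makes `κ_s` blow up at
`p`. -/
theorem abs_kappaS (hsl : slope G F (c t) ≠ 0) (ha : deriv c t 0 ≠ 0) {η : E2 → E2}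
    (hη : η (c t) 1 ≠ 0) :
    |kappaS G F N c η t| =
      |G (F (c t)) (conormal G F N (c t)) (covD G F (pd F 0) (c t) (e2 1))| /
        (|slope G F (c t)| * normG G (F (c t)) (pd F 1 (c t)) ^ 3) := by
  have hn := h.normG_pd_pos hct
  have hsign : |Real.sign (fderiv ℝ (lam G F N) (c t) (η (c t)))| = 1 := by
    rw [h.fderiv_lam_eq hct hax.self_of_nhds]
    rcases Real.sign_apply_eq_of_ne_zero _
      (mul_ne_zero hη (h.fderiv_lam_ne_zero _ hct)) with h1 | h1 <;> rw [h1] <;> simp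
  rw [kappaS, h.detG_vel_acc hct hc hax, h.vel_eq hct hc hax, normG_smul, abs_div, abs_mul,
    hsign, abs_neg, one_mul, speed]
  simp only [abs_mul, abs_pow, abs_abs, abs_of_pos hn]
  have h1 := abs_pos.2 hsl
  have h2 := abs_pos.2 ha
  field_simp

/-- On the axis `h_uv = s h_vv`, and the tangential part of the acceleration is invisible to `ν`.
The right-hand side makes sense at `p` too, so it gives the continuous extension of `κ_ν`. -/
theorem kappaNuCurve_eq (hsl : slope G F (c t) ≠ 0) (ha : deriv c t 0 ≠ 0) :
    kappaNuCurve G F N c t = kappaNu G F N 1 (c t) := by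
  have hn := h.normG_pd_pos hct
  have hD : G (F (c t)) (covD G F (pd F 0) (c t) (e2 1)) (N (c t)) =
      slope G F (c t) * secondFF G F N 1 1 (c t) := by
    rw [← h.secondFF_eq hct, h.secondFF_zero hct, h.height_eq_zero hct hax.self_of_nhds]
    ring
  rw [kappaNuCurve, kappaNu, ← h.secondFF_eq hct, h.acc_eq hct hc hax, h.vel_eq hct hc hax,
    normG_smul]
  simp only [map_add, map_smul, add_apply, smul_apply, smul_eq_mul, h.normal_pd hct, hD]
  rw [mul_pow, sq_abs, speed]
  field_simp
  ring

omit hc hax in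
theorem null_coord_eq {w : E2} (hw : fderiv ℝ F (c t) w = 0) (h1 : c t 1 = 0) :
    w 1 = - (w 0 * slope G F (c t)) := by
  rw [fderiv_eq_smul_pd_add, h.pd_zero_eq_smul hct h1, smul_smul, ← add_smul] at hw
  rcases smul_eq_zero.1 hw with h2 | h2
  · linarith
  · exact absurd h2 (h.pd_ne_zero _ hct)

end IsAdaptedFrontal

/-- The differential of a function in the direction of a vector field is smooth. -/
theorem contDiffAt_dir {s : E2 → ℝ} {η : E2 → E2} (hs : ContDiffAt ℝ ∞ s z)
    (hη : ContDiffAt ℝ ∞ η z) : ContDiffAt ℝ ∞ (fun y => fderiv ℝ s y (η y)) z :=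
  (hs.fderiv_right (m := ∞) (by simp)).clm_apply hη

namespace IsAdaptedFrontal

variable (h : IsAdaptedFrontal G Y F N V) (hz : z ∈ V) {η : E2 → E2} (hη : ContDiffAt ℝ ∞ η z)

/-- The coefficients of `f_η` in the frame `f_v × ν, f_v`. -/
theorem fη_eq (hz : z ∈ V) (h : IsAdaptedFrontal G Y F N V) :
    fη F η z = (η z 0 * height G F N z) • conormal G F N z +
      (η z 0 * slope G F z + η z 1) • pd F 1 z := by
  rw [fη, fderiv_eq_smul_pd_add, h.pd_zero_eq hz]
  module

include h hz hη

/-- The vector `f_{ηη}` and the `ν`-component of `f_{ηηη}` at a point where `η` is null. -/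
theorem fηη_fηηη (hz1 : z 1 = 0) (hnull : fη F η z = 0) : ∃ ρ : ℝ,
    fηη G F η z = (η z 0 * (η z 1 * (fderiv ℝ (lam G F N) z (e2 1) / firstFF G F 1 1 z))) •
      conormal G F N z + ρ • pd F 1 z ∧
    G (F z) (fηηη G F η z) (N z) =
      - 2 * (η z 0 * (η z 1 * (fderiv ℝ (lam G F N) z (e2 1) / firstFF G F 1 1 z))) *
        (η z 0 * (conormalFF G F N 0 z - slope G F z * conormalFF G F N 1 z)) := by
  have hη' := contDiffAt_euclidean.1 hη
  -- `m` and `n` are the coefficients of `f_η` in the frame; both vanish at `z` because `η` is null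
  -- there.
  set m : E2 → ℝ := fun y => η y 0 * height G F N y with hm_def
  set n : E2 → ℝ := fun y => η y 0 * slope G F y + η y 1 with hn_def
  have hm : ContDiffAt ℝ ∞ m z := (hη' 0).mul (h.contDiffAt_height hz)
  have hn : ContDiffAt ℝ ∞ n z := ((hη' 0).mul (h.contDiffAt_slope hz)).add (hη' 1)
  have hP := h.contDiffAt_conormal hz
  have hQ := contDiffAt_pd (h.smooth z hz) 1
  have hm0 : m z = 0 := by simp [hm_def, h.height_eq_zero hz hz1]
  have hn0 : n z = 0 := by
    have := fη_eq (η := η) hz h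
    rw [hnull, show η z 0 * height G F N z = 0 from hm0, zero_smul, zero_add] at this
    exact (smul_eq_zero.1 this.symm).resolve_right (h.pd_ne_zero z hz)
  have hm1 : fderiv ℝ m z (η z) =
      η z 0 * (η z 1 * (fderiv ℝ (lam G F N) z (e2 1) / firstFF G F 1 1 z)) := by
    rw [hm_def, fderiv_fun_mul ((hη' 0).differentiableAt (by simp))
      ((h.contDiffAt_height hz).differentiableAt (by simp)), h.height_eq_zero hz hz1]
    simp [h.fderiv_height_eq hz hz1]
  have hη_near : ∀ᶠ y in 𝓝 z, ∀ i, ContDiffAt ℝ 1 (fun y => η y i) y := by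
    refine eventually_all.2 fun i => ?_
    exact ((hη' i).of_le (by simp : (1 : WithTop ℕ∞) ≤ ∞)).eventually (by simp)
  -- The expansion is needed on a neighbourhood, not only at `z`, since it is differentiated once
  -- more for `f_ηηη`.
  have hff : fηη G F η =ᶠ[𝓝 z] fun y =>
      (fderiv ℝ m y (η y) • conormal G F N y + m y • covD G F (conormal G F N) y (η y)) +
      (fderiv ℝ n y (η y) • pd F 1 y + n y • covD G F (pd F 1) y (η y)) := by
    filter_upwards [h.eventually_mem hz, hη_near] with y hy hηy
    have hd : ∀ i, DifferentiableAt ℝ (fun y => η y i) y :=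
      fun i => (hηy i).differentiableAt (by simp)
    have hP := h.contDiffAt_conormal hy
    have hQ := contDiffAt_pd (h.smooth y hy) 1
    have hmy : DifferentiableAt ℝ m y :=
      (hd 0).mul ((h.contDiffAt_height hy).differentiableAt (by simp))
    have hny : DifferentiableAt ℝ n y :=
      ((hd 0).mul ((h.contDiffAt_slope hy).differentiableAt (by simp))).add (hd 1)
    have hW : fη F η =ᶠ[𝓝 y] fun y => m y • conormal G F N y + n y • pd F 1 y := by
      filter_upwards [h.eventually_mem hy] with y' hy' using fη_eq hy' h
    rw [fηη, covD_congr hW, covD_smul_add_smul hmy (hP.differentiableAt (by simp)) hny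
      (hQ.differentiableAt (by simp))]
  refine ⟨fderiv ℝ n z (η z), ?_, ?_⟩
  · rw [hff.self_of_nhds]
    simp only [hm0, hn0, hm1, zero_smul, add_zero]
  · have hdm := contDiffAt_dir hm hη
    have hdn := contDiffAt_dir hn hη
    have hcP := h.contDiffAt_covD hz hP hη
    have hcQ := h.contDiffAt_covD hz hQ hη
    have hd : ∀ {s : E2 → ℝ}, ContDiffAt ℝ ∞ s z → DifferentiableAt ℝ s z :=
      fun hs => hs.differentiableAt (by simp)
    have hd3 : ∀ {s : E2 → E3}, ContDiffAt ℝ ∞ s z → DifferentiableAt ℝ s z :=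
      fun hs => hs.differentiableAt (by simp)
    have hN1 : G (F z) (conormal G F N z) (N z) = 0 := h.conormal_normal hz
    have hN2 : G (F z) (pd F 1 z) (N z) = 0 := h.normal_pd hz 1
    have hη1 : η z 1 = - (η z 0 * slope G F z) := by
      have : η z 0 * slope G F z + η z 1 = 0 := hn0
      linarith
    have hN3 : G (F z) (covD G F (conormal G F N) z (η z)) (N z) =
        - (η z 0 * (conormalFF G F N 0 z - slope G F z * conormalFF G F N 1 z)) := by
      rw [h.covD_apply_normal hz hP fun y hy => h.conormal_normal hy]
      conv_lhs => rw [eq_smul_e2_add (η z), covD_add_dir, covD_smul_dir, covD_smul_dir, hη1]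
      simp only [conormalFF, map_add, map_smul, smul_eq_mul]
      ring
    -- By symmetry of the second fundamental form this pairs `f_η = 0` with `∇_v ν`; in coordinates
    -- it is `η_u (h_uv - s h_vv) = 0`.
    have hN4 : G (F z) (covD G F (pd F 1) z (η z)) (N z) = 0 := by
      conv_lhs => rw [eq_smul_e2_add (η z), covD_add_dir, covD_smul_dir, covD_smul_dir, hη1]
      simp only [map_add, map_smul, add_apply, smul_apply, smul_eq_mul]
      rw [← h.secondFF_eq hz, ← h.secondFF_eq hz, ← h.secondFF_comm hz, h.secondFF_zero hz,
        h.height_eq_zero hz hz1]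
      ring
    -- Against `ν` the frame vectors vanish, terms containing `m(z)` or `n(z)` vanish, and `∇_η f_v`
    -- vanishes by `hN4`. Only `dm(η) ∇_η (f_v × ν)` is left; the Leibniz rule produces it twice,
    -- whence the factor 2.
    rw [fηηη, covD_congr hff,
      covD_add (((hd hdm).fun_smul (hd3 hP)).fun_add ((hd hm).fun_smul (hd3 hcP)))
        (((hd hdn).fun_smul (hd3 hQ)).fun_add ((hd hn).fun_smul (hd3 hcQ))),
      covD_smul_add_smul (hd hdm) (hd3 hP) (hd hm) (hd3 hcP),
      covD_smul_add_smul (hd hdn) (hd3 hQ) (hd hn) (hd3 hcQ), hm0, hn0, hm1]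
    simp only [map_add, map_smul, add_apply, smul_apply, smul_eq_mul, hN1, hN2, hN3, hN4]
    ring

end IsAdaptedFrontal

end CurveInvariants

/-! ### Limits at the singular point of the second kind -/

section Limits

variable {G : E3 → E3 →L[ℝ] E3 →L[ℝ] ℝ} {Y : Set E3} {F N : E2 → E3} {V : Set E2} {z : E2}

theorem sq_rpow_natCast_div_two {x : ℝ} (hx : 0 ≤ x) (k : ℕ) :
    (x ^ 2) ^ ((k : ℝ) / 2) = x ^ k := by
  rw [← Real.rpow_natCast x 2, ← Real.rpow_mul hx, ← Real.rpow_natCast x k]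
  congr 1
  push_cast
  ring

/-- Homogeneity count: the total exponents of `r, n, a, e` are zero and those of `τ, j` are `-1/2`.
It is used with `r` the speed, `n = |f_v|`, `a = |η_u|`, `e = |s|`, `τ = |λ_v| / |f_v|²` and `j =
|J|`. Writing the bases as squares turns the real powers into integer ones. -/
theorem cuspidal_ratio {r n a e τ j : ℝ} (K : ℝ) (hr : 0 < r) (hn : 0 < n) (ha : 0 < a)
    (he : 0 < e) (hτ : 0 < τ) (hj : 0 < j) :
    ((r * n) ^ (3 / 2 : ℝ) * (2 * r * (a ^ 2 * e * τ) ^ 2 * n ^ 2 * a * K) /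
      (r * (a ^ 2 * e * τ) * n ^ 2) ^ (5 / 2 : ℝ)) / (2 * (j / (e * n ^ 3)) ^ (1 / 2 : ℝ)) =
      K / √(τ * j) := by
  obtain ⟨R, hR, rfl⟩ : ∃ x, 0 < x ∧ x ^ 2 = r := ⟨√r, Real.sqrt_pos.2 hr, Real.sq_sqrt hr.le⟩
  obtain ⟨M, hM, rfl⟩ : ∃ x, 0 < x ∧ x ^ 2 = n := ⟨√n, Real.sqrt_pos.2 hn, Real.sq_sqrt hn.le⟩
  obtain ⟨S, hS, rfl⟩ : ∃ x, 0 < x ∧ x ^ 2 = e := ⟨√e, Real.sqrt_pos.2 he, Real.sq_sqrt he.le⟩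
  obtain ⟨T, hT, rfl⟩ : ∃ x, 0 < x ∧ x ^ 2 = τ := ⟨√τ, Real.sqrt_pos.2 hτ, Real.sq_sqrt hτ.le⟩
  obtain ⟨J, hJ, rfl⟩ : ∃ x, 0 < x ∧ x ^ 2 = j := ⟨√j, Real.sqrt_pos.2 hj, Real.sq_sqrt hj.le⟩
  have h1 : (R ^ 2 * M ^ 2) ^ (3 / 2 : ℝ) = (R * M) ^ 3 := by
    rw [← mul_pow]
    exact_mod_cast sq_rpow_natCast_div_two (mul_pos hR hM).le 3
  have h2 : (R ^ 2 * (a ^ 2 * S ^ 2 * T ^ 2) * (M ^ 2) ^ 2) ^ (5 / 2 : ℝ) =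
      (R * (a * S * T) * M ^ 2) ^ 5 := by
    rw [← mul_pow, ← mul_pow, ← mul_pow, ← mul_pow]
    exact_mod_cast sq_rpow_natCast_div_two (by positivity : 0 ≤ R * (a * S * T) * M ^ 2) 5
  have h3 : (J ^ 2 / (S ^ 2 * (M ^ 2) ^ 3)) ^ (1 / 2 : ℝ) = J / (S * M ^ 3) := by
    rw [show J ^ 2 / (S ^ 2 * (M ^ 2) ^ 3) = (J / (S * M ^ 3)) ^ 2 by ring]
    simpa using sq_rpow_natCast_div_two (by positivity : 0 ≤ J / (S * M ^ 3)) 1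
  rw [h1, h2, h3, ← mul_pow T J, Real.sqrt_sq (mul_pos hT hJ).le]
  field_simp

namespace IsAdaptedFrontal

/-- The pairing `⟨f_v × ν, ∇_v f_u⟩`. -/
def conormalAcc (G : E3 → E3 →L[ℝ] E3 →L[ℝ] ℝ) (F N : E2 → E3) (z : E2) : ℝ :=
  G (F z) (conormal G F N z) (covD G F (pd F 0) z (e2 1))

theorem contDiffAt_conormalAcc (h : IsAdaptedFrontal G Y F N V) (hz : z ∈ V) :
    ContDiffAt ℝ ∞ (conormalAcc G F N) z :=
  h.metric.contDiffAt_apply (h.mapsTo z hz) (h.smooth z hz) (h.contDiffAt_conormal hz)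
    (h.contDiffAt_covD hz (contDiffAt_pd (h.smooth z hz) 0) contDiffAt_const)

/-- Since `λ = ⟨f_v × ν, f_u⟩`, metric compatibility gives two terms, and the one containing `f_u`
undifferentiated vanishes. -/
theorem fderiv_lam_eq_conormalAcc (h : IsAdaptedFrontal G Y F N V) (hz : z ∈ V)
    (h0 : pd F 0 z = 0) : fderiv ℝ (lam G F N) z (e2 1) = conormalAcc G F N z := by
  have h1 : lam G F N =ᶠ[𝓝 z] fun y => G (F y) (conormal G F N y) (pd F 0 y) := by
    filter_upwards [h.eventually_mem hz] with y hy
    rw [h.conormal_apply hy, lam, detG_rotate]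
  rw [h1.fderiv_eq, h.metric.fderiv_apply (h.mapsTo z hz)
    ((h.smooth z hz).differentiableAt (by simp))
    ((h.contDiffAt_conormal hz).differentiableAt (by simp))
    ((contDiffAt_pd (h.smooth z hz) 0).differentiableAt (by simp)), h0, map_zero, zero_add,
    conormalAcc]

theorem slope_eq_zero (h0 : pd F 0 z = 0) : slope G F z = 0 := by
  simp [slope, firstFF, h0]

/-- The ratio of `λ` and `v` tends to `λ_v`. -/
theorem tendsto_lam_div (h : IsAdaptedFrontal G Y F N V) (h0 : 0 ∈ V) :
    Tendsto (fun z : E2 => lam G F N z / z 1) (𝓝[{z : E2 | z 1 ≠ 0}] 0)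
      (𝓝 (fderiv ℝ (lam G F N) 0 (e2 1))) := by
  -- Strict differentiability compares `z` with its projection to the axis, where `λ = 0`. The error
  -- is then `o(v)` and not merely `o(|z|)`, as is needed for unrestricted approach to the origin.
  have hs : HasStrictFDerivAt (lam G F N) (fderiv ℝ (lam G F N) 0) 0 :=
    (h.contDiffAt_lam h0).hasStrictFDerivAt (by simp)
  have hc0 : ContinuousAt (fun z : E2 => z 0 • e2 0) 0 := by fun_prop
  have hpair : Tendsto (fun z : E2 => (z, z 0 • e2 0)) (𝓝 0) (𝓝 ((0 : E2), (0 : E2))) := by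
    refine tendsto_id.prodMk_nhds ?_
    simpa using hc0.tendsto
  have ho := hs.isLittleO.comp_tendsto hpair
  have hV : ∀ᶠ z : E2 in 𝓝 0, z 0 • e2 0 ∈ V := by
    have : Tendsto (fun z : E2 => z 0 • e2 0) (𝓝 0) (𝓝 0) := by simpa using hc0.tendsto
    exact this.eventually (h.eventually_mem h0)
  have hdiff : ∀ z : E2, z - z 0 • e2 0 = z 1 • e2 1 := fun z => by
    conv_lhs => rw [eq_smul_e2_add z]
    simp [e2]
  have ho' : (fun z : E2 => lam G F N z - z 1 * fderiv ℝ (lam G F N) 0 (e2 1)) =o[𝓝 0]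
      fun z : E2 => z 1 := by
    refine (ho.congr' ?_ (Eventually.of_forall fun z => ?_)).trans_isBigO
      (Asymptotics.IsBigO.of_bound 1 (g := fun z : E2 => z 1)
        (f := fun z : E2 => z 1 • e2 1) (Eventually.of_forall fun z => ?_))
    · filter_upwards [hV] with z hz
      simp only [Function.comp_apply]
      rw [hdiff, h.lam_eq_zero _ hz (by simp [e2]), map_smul, smul_eq_mul, sub_zero]
    · exact hdiff z
    · simp [norm_smul, e2]
  have ht := (ho'.mono nhdsWithin_le_nhds).tendsto_div_nhds_zero
    (l := 𝓝[{z : E2 | z 1 ≠ 0}] 0)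
  have ht' := ht.add_const (fderiv ℝ (lam G F N) 0 (e2 1))
  rw [zero_add] at ht'
  refine ht'.congr' ?_
  filter_upwards [self_mem_nhdsWithin] with z hz
  have hz : z 1 ≠ 0 := hz
  field_simp
  ring

/-- The limit of `2 v H` at a singular point of the second kind. -/
theorem isKappaH (h : IsAdaptedFrontal G Y F N V) (h0 : 0 ∈ V) (hu : pd F 0 0 = 0) :
    IsKappaH G F N (- conormalFF G F N 0 0 / conormalAcc G F N 0) := by
  have hlv := h.fderiv_lam_ne_zero 0 h0
  have ht := h.tendsto_lam_div h0
  have hX : Tendsto (fun z => height G F N z * secondFF G F N 1 1 z +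
      slope G F z * conormalFF G F N 1 z - conormalFF G F N 0 z) (𝓝[{z : E2 | z 1 ≠ 0}] 0)
      (𝓝 (- conormalFF G F N 0 0)) := by
    have hc : ContDiffAt ℝ ∞ (fun z => height G F N z * secondFF G F N 1 1 z +
        slope G F z * conormalFF G F N 1 z - conormalFF G F N 0 z) 0 :=
      (((h.contDiffAt_height h0).mul (h.contDiffAt_secondFF h0 1 1)).add
        ((h.contDiffAt_slope h0).mul (h.contDiffAt_conormalFF h0 1))).sub
        (h.contDiffAt_conormalFF h0 0)
    have := hc.continuousAt.tendsto
    rw [h.height_eq_zero h0 (by simp), slope_eq_zero hu] at this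
    simp only [zero_mul, zero_add, zero_sub] at this
    exact this.mono_left nhdsWithin_le_nhds
  have hlim := (ht.inv₀ hlv).mul hX
  rw [h.fderiv_lam_eq_conormalAcc h0 hu] at hlim
  rw [IsKappaH, div_eq_inv_mul]
  refine hlim.congr' ?_
  -- Since `λ / v` has a nonzero limit, `λ ≠ 0` off the axis near the origin, so the formula for `H`
  -- applies.
  filter_upwards [ht.eventually_ne hlv, nhdsWithin_le_nhds (h.eventually_mem h0)] with z hz hzV
  rw [h.meanCurvature_eq hzV (fun h1 => hz (by rw [h1, zero_div])), inv_div]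

section

variable {c : ℝ → E2} {t : ℝ} (h : IsAdaptedFrontal G Y F N V) (hct : c t ∈ V)
  (hc : ContDiffAt ℝ ∞ c t) (hax : ∀ᶠ s in 𝓝 t, c s 1 = 0)
  (hsl : slope G F (c t) ≠ 0) (ha : deriv c t 0 ≠ 0) {η : E2 → E2}
  (hη : ContDiffAt ℝ ∞ η (c t)) (hnull : fη F η (c t) = 0) (hη0 : η (c t) ≠ 0)

include h hct hax hsl hnull hη0

theorem null_coords_ne_zero : η (c t) 0 ≠ 0 ∧ η (c t) 1 ≠ 0 := by
  have h1 := h.null_coord_eq hct hnull hax.self_of_nhds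
  have h2 : η (c t) 0 ≠ 0 := fun h2 => hη0 <| by
    rw [eq_smul_e2_add (η (c t)), h1, h2]
    simp
  exact ⟨h2, by rw [h1]; exact neg_ne_zero.2 (mul_ne_zero h2 hsl)⟩

include hc hη ha

/-- Both curvatures are singular as `s → 0`, but their singular powers of `s` match. The right-hand
side is continuous at `p`, where its denominator does not vanish. -/
theorem abs_kappaC_div (hj : conormalAcc G F N (c t) ≠ 0) :
    |kappaC G F c η t| / (2 * |kappaS G F N c η t| ^ (1 / 2 : ℝ)) =
      |conormalFF G F N 0 (c t) - slope G F (c t) * conormalFF G F N 1 (c t)| /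
        √(|fderiv ℝ (lam G F N) (c t) (e2 1) / firstFF G F 1 1 (c t)| *
          |conormalAcc G F N (c t)|) := by
  obtain ⟨hη0', hη1⟩ := h.null_coords_ne_zero hct hax hsl hnull hη0
  have hz1 := hax.self_of_nhds
  have hβ := h.null_coord_eq hct hnull hz1
  obtain ⟨ρ, h2, h3⟩ := h.fηη_fηηη hct hη hz1 hnull
  have hn := h.normG_pd_pos hct
  have hn2 := h.normG_pd_sq hct
  have hE := h.firstFF_pos hct
  have hlv := h.fderiv_lam_ne_zero _ hct
  have hvel := h.vel_eq hct hc hax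
  have hsp : speed G F c t ≠ 0 := mul_ne_zero ha hsl
  set z := c t with hz
  set n := normG G (F z) (pd F 1 z) with hn_def
  set τ := fderiv ℝ (lam G F N) z (e2 1) / firstFF G F 1 1 z with hτ_def
  set K := conormalFF G F N 0 z - slope G F z * conormalFF G F N 1 z with hK
  set μ := η z 0 * (η z 1 * τ) with hμ
  have hτ : τ ≠ 0 := div_ne_zero hlv hE.ne'
  have hμabs : |μ| = |η z 0| ^ 2 * |slope G F z| * |τ| := by
    rw [hμ, hβ]
    simp only [abs_mul, abs_neg]
    ring
  have hvn : normG G (F z) (vel F c t) = |speed G F c t| * n := by rw [hvel, normG_smul]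
  -- The velocity is parallel to `f_v`, so the unknown `f_v`-component `ρ` of `f_ηη` does not
  -- contribute.
  have hdet : ∀ w, detG G (F z) (vel F c t) (fηη G F η z) w =
      - (speed G F c t * μ * n ^ 2 * G (F z) w (N z)) := fun w => by
    rw [hvel, h2, detG_smul_left, detG_add_mid, detG_smul_mid, detG_smul_mid, detG_self_left,
      h.detG_pd_conormal hct, hn2]
    ring
  have hcross : normG G (F z) (crossG G (F z) (vel F c t) (fηη G F η z)) =
      |speed G F c t| * (|η z 0| ^ 2 * |slope G F z| * |τ|) * n ^ 2 := by
    rw [h.metric.normG_crossG (h.mapsTo z hct) (h.unit z hct), hdet, h.unit z hct]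
    · rw [mul_one, abs_neg, abs_mul, abs_mul, hμabs, abs_of_pos (pow_pos hn 2)]
    · rw [hvel, map_smul, smul_apply, h.normal_pd hct, smul_zero]
    · rw [h2, map_add, map_smul, map_smul, add_apply, smul_apply, smul_apply, h.normal_pd hct,
        h.conormal_normal hct]
      simp
  rw [h.abs_kappaS hct hc hax hsl ha hη1, kappaC, ← hz, hvn, hcross, hdet, h3,
    ← cuspidal_ratio |K| (abs_pos.2 hsp) hn (abs_pos.2 hη0') (abs_pos.2 hsl) (abs_pos.2 hτ)
      (abs_pos.2 hj)]
  congr 1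
  rw [abs_div, abs_mul, abs_of_nonneg (Real.rpow_nonneg (by positivity) _),
    abs_of_nonneg (Real.rpow_nonneg (by positivity) (5 / 2 : ℝ)), ← hμabs]
  congr 2
  simp only [abs_neg, abs_mul, abs_of_pos (pow_pos hn 2), abs_of_pos (two_pos (α := ℝ))]
  ring

end

/-- Limits of the invariants along a curve of singular points of the first kind that ends at a
singular point of the second kind. -/
theorem curve_limits (h : IsAdaptedFrontal G Y F N V) (h0 : 0 ∈ V) (hu : pd F 0 0 = 0)
    (hv : normG G (F 0) (pd F 1 0) = 1) {c : ℝ → E2} (hc0 : c 0 = 0)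
    (hc : ∀ᶠ t in 𝓝 (0 : ℝ), ContDiffAt ℝ ∞ c t ∧ deriv c t ≠ 0 ∧ c t 1 = 0)
    (hfirst : ∀ᶠ t in 𝓝[≠] (0 : ℝ), pd F 0 (c t) ≠ 0) {η : ℝ → E2 → E2}
    (hη : ∀ᶠ t in 𝓝[≠] (0 : ℝ), ContDiffAt ℝ ∞ (η t) (c t) ∧ fη F (η t) (c t) = 0 ∧
      η t (c t) ≠ 0) :
    ∃ κH : ℝ, IsKappaH G F N κH ∧
      (∀ᶠ t in 𝓝[≠] (0 : ℝ), kappaS G F N c (η t) t ≠ 0) ∧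
      Tendsto (fun t => |kappaC G F c (η t) t| / (2 * |kappaS G F N c (η t) t| ^ (1 / 2 : ℝ)))
        (𝓝[≠] 0) (𝓝 |κH|) ∧
      (kappaNu G F N 1 0 * κH ≠ 0 → ¬ Tendsto (fun t => kappaPi G F N c (η t) t) (𝓝[≠] 0)
        (𝓝 (kappaNu G F N 1 0 * κH))) := by
  have hE1 : firstFF G F 1 1 0 = 1 := by rw [← h.normG_pd_sq h0, hv, one_pow]
  have hj0 : conormalAcc G F N 0 ≠ 0 := by
    rw [← h.fderiv_lam_eq_conormalAcc h0 hu]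
    exact h.fderiv_lam_ne_zero 0 h0
  have hcc : Tendsto c (𝓝[≠] 0) (𝓝 0) := by
    have := hc.self_of_nhds.1.continuousAt.tendsto
    rw [hc0] at this
    exact this.mono_left nhdsWithin_le_nhds
  have hlim : ∀ {s : E2 → ℝ}, ContDiffAt ℝ ∞ s 0 →
      Tendsto (fun t => s (c t)) (𝓝[≠] 0) (𝓝 (s 0)) :=
    fun hs => hs.continuousAt.tendsto.comp hcc
  -- On the axis `f_u = s f_v`, so `f_u ≠ 0` forces `s ≠ 0`; regularity of a curve in the axis
  -- forces `u' ≠ 0`.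
  have hall : ∀ᶠ t in 𝓝[≠] (0 : ℝ), c t ∈ V ∧ ContDiffAt ℝ ∞ c t ∧
      (∀ᶠ s in 𝓝 t, c s 1 = 0) ∧ slope G F (c t) ≠ 0 ∧ deriv c t 0 ≠ 0 ∧
      conormalAcc G F N (c t) ≠ 0 := by
    filter_upwards [hcc.eventually (h.eventually_mem h0), nhdsWithin_le_nhds hc,
      nhdsWithin_le_nhds (eventually_eventually_nhds.2 hc), hfirst,
      (hlim (h.contDiffAt_conormalAcc h0)).eventually_ne hj0] with t hV ht ht' hft hj
    have hax : ∀ᶠ s in 𝓝 t, c s 1 = 0 := ht'.mono fun s hs => hs.2.2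
    refine ⟨hV, ht.1, hax, fun hsl => hft ?_, fun hd => ht.2.1 ?_, hj⟩
    · rw [h.pd_zero_eq_smul hV ht.2.2, hsl, zero_smul]
    · rw [eq_smul_e2_add (deriv c t), hd,
        deriv_coord_eq_zero (ht.1.differentiableAt (by simp)) hax]
      simp
  have hκs : ∀ᶠ t in 𝓝[≠] (0 : ℝ), |kappaS G F N c (η t) t| =
      |conormalAcc G F N (c t)| /
        (|slope G F (c t)| * normG G (F (c t)) (pd F 1 (c t)) ^ 3) := by
    filter_upwards [hall, hη] with t ⟨hV, h1, h2, h3, h4, _⟩ ⟨_, h6, h7⟩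
    exact h.abs_kappaS hV h1 h2 h3 h4 (h.null_coords_ne_zero hV h2 h3 h6 h7).2
  have hratio : Tendsto
      (fun t => |kappaC G F c (η t) t| / (2 * |kappaS G F N c (η t) t| ^ (1 / 2 : ℝ)))
      (𝓝[≠] 0) (𝓝 |- conormalFF G F N 0 0 / conormalAcc G F N 0|) := by
    have hlv : ContDiffAt ℝ ∞ (fun z => fderiv ℝ (lam G F N) z (e2 1)) 0 :=
      contDiffAt_dir (h.contDiffAt_lam h0) contDiffAt_const
    have hnum := (hlim ((h.contDiffAt_conormalFF h0 0).sub
      ((h.contDiffAt_slope h0).mul (h.contDiffAt_conormalFF h0 1)))).abs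
    have hden := Tendsto.sqrt ((hlim (hlv.div (h.contDiffAt_firstFF h0 1 1)
      (h.firstFF_pos h0).ne')).abs.mul (hlim (h.contDiffAt_conormalAcc h0)).abs)
    -- At `p` both factors under the root equal `|J|`, since `|f_v| = 1` and `λ_v = J` there.
    have hval : √(|fderiv ℝ (lam G F N) 0 (e2 1) / firstFF G F 1 1 0| *
        |conormalAcc G F N 0|) = |conormalAcc G F N 0| := by
      rw [h.fderiv_lam_eq_conormalAcc h0 hu, hE1, div_one, Real.sqrt_mul_self (abs_nonneg _)]
    simp only [Pi.div_apply, slope_eq_zero hu, zero_mul, sub_zero] at hnum hden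
    rw [hval] at hden
    have hq := hnum.div hden (abs_ne_zero.2 hj0)
    rw [abs_div, abs_neg]
    refine hq.congr' ?_
    filter_upwards [hall, hη] with t ⟨hV, h1, h2, h3, h4, hj⟩ ⟨h5, h6, h7⟩
    exact (h.abs_kappaC_div hV h1 h2 h3 h4 h5 h6 h7 hj).symm
  refine ⟨_, h.isKappaH h0 hu, ?_, hratio, fun hne hT => ?_⟩
  · filter_upwards [hall, hκs] with t ⟨hV, _, _, h3, _, hj⟩ hs
    rw [← abs_ne_zero, hs]
    have := h.normG_pd_pos hV
    positivity
  · have hnu : ContDiffAt ℝ ∞ (fun z => secondFF G F N 1 1 z / firstFF G F 1 1 z) 0 :=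
      (h.contDiffAt_secondFF h0 1 1).div (h.contDiffAt_firstFF h0 1 1) (h.firstFF_pos h0).ne'
    have hnu_eq : ∀ z ∈ V, kappaNu G F N 1 z = secondFF G F N 1 1 z / firstFF G F 1 1 z :=
      fun z hz => by rw [kappaNu, ← h.secondFF_eq hz, h.normG_pd_sq hz]
    have hsat : Tendsto (fun t => |kappaS G F N c (η t) t|) (𝓝[≠] 0) atTop := by
      have hnorm : Tendsto (fun t => normG G (F (c t)) (pd F 1 (c t))) (𝓝[≠] 0) (𝓝 1) := by
        rw [← hv]
        exact Tendsto.sqrt (hlim (h.contDiffAt_firstFF h0 1 1))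
      have hfac : Tendsto (fun t => |conormalAcc G F N (c t)| /
          normG G (F (c t)) (pd F 1 (c t)) ^ 3) (𝓝[≠] 0) (𝓝 (|conormalAcc G F N 0| / 1 ^ 3)) :=
        (hlim (h.contDiffAt_conormalAcc h0)).abs.div (hnorm.pow 3) (by norm_num)
      have hinv : Tendsto (fun t => |slope G F (c t)|⁻¹) (𝓝[≠] 0) atTop := by
        refine tendsto_inv_nhdsGT_zero.comp (tendsto_nhdsWithin_iff.2 ⟨?_, ?_⟩)
        · have := (hlim (h.contDiffAt_slope h0)).abs
          rwa [slope_eq_zero hu, abs_zero] at this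
        · filter_upwards [hall] with t ht using abs_pos.2 ht.2.2.2.1
      refine (hfac.pos_mul_atTop (by positivity) hinv).congr' ?_
      filter_upwards [hκs] with t ht
      rw [ht]
      ring
    have hroot : Tendsto (fun t => 2 * |kappaS G F N c (η t) t| ^ (1 / 2 : ℝ)) (𝓝[≠] 0) atTop :=
      ((tendsto_rpow_atTop (by norm_num : (0 : ℝ) < 1 / 2)).comp hsat).const_mul_atTop
        (by norm_num)
    -- `|κ_ν|` times the ratio has the positive limit `|κ_ν(p) κ_H(p)|`; multiplied by `2
    -- |κ_s|^{1/2}` it recovers `|κ_Π|`.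
    have hprod := ((hlim hnu).abs.mul hratio).pos_mul_atTop
      (by rw [← hnu_eq 0 h0, ← abs_mul]; exact abs_pos.2 hne) hroot
    have habs : Tendsto (fun t => |kappaPi G F N c (η t) t|) (𝓝[≠] 0) atTop := by
      refine hprod.congr' ?_
      filter_upwards [hall, hsat.eventually_gt_atTop 0] with t ⟨hV, h1, h2, h3, h4, _⟩ hpos
      have hp := Real.rpow_pos_of_pos hpos (1 / 2 : ℝ)
      rw [kappaPi, h.kappaNuCurve_eq hV h1 h2 h3 h4, hnu_eq _ hV, abs_mul]
      field_simp
    exact not_tendsto_nhds_of_tendsto_atTop habs _ hT.abs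

end IsAdaptedFrontal

end Limits

set_option linter.unusedSectionVars false

/-! ### Smoothness of tangent vector fields read in a chart -/

section Charts

theorem mdifferentiable_of_mem {k : ℕ} {H : Type*} [TopologicalSpace H]
    [ChartedSpace (EuclideanSpace ℝ (Fin k)) H]
    {e : OpenPartialHomeomorph H (EuclideanSpace ℝ (Fin k))} (he : e ∈ IsManifold.maximalAtlas (𝓡 k) ∞ H) :
    e.MDifferentiable (𝓡 k) (𝓡 k) :=
  ⟨(contMDiffOn_of_mem_maximalAtlas he).mdifferentiableOn (by simp),
    (contMDiffOn_symm_of_mem_maximalAtlas he).mdifferentiableOn (by simp)⟩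

variable {k : ℕ} {H : Type*} [TopologicalSpace H] [ChartedSpace (EuclideanSpace ℝ (Fin k)) H]
  [IsManifold (𝓡 k) ∞ H] {e : OpenPartialHomeomorph H (EuclideanSpace ℝ (Fin k))}
  {X : Type*} [NormedAddCommGroup X] [NormedSpace ℝ X] {B : Type*} [TopologicalSpace B]
  {I : ModelWithCorners ℝ X B} {K : Type*} [TopologicalSpace K] [ChartedSpace B K]

/-- The coordinate expression of a smooth family of tangent vectors is smooth. -/
theorem contMDiffAt_mfderiv_chart (he : e ∈ IsManifold.maximalAtlas (𝓡 k) ∞ H)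
    {b : K → H} {σ : ∀ q, TangentSpace (𝓡 k) (b q)} {q₀ : K}
    (hσ : ContMDiffAt I (𝓡 k).tangent ∞ (fun q => (⟨b q, σ q⟩ : TangentBundle (𝓡 k) H)) q₀)
    (hq : b q₀ ∈ e.source) :
    ContMDiffAt I 𝓘(ℝ, EuclideanSpace ℝ (Fin k)) ∞
      (fun q => (mfderiv (𝓡 k) (𝓡 k) e (b q) (σ q) : EuclideanSpace ℝ (Fin k))) q₀ := by
  have : IsManifold (𝓡 k) 1 H := IsManifold.of_le (n := ∞) (by simp)
  have h1 := (contMDiffOn_of_mem_maximalAtlas he).contMDiffOn_tangentMapWithin (m := ∞)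
    (by simp) e.open_source.uniqueMDiffOn
  have hopen : IsOpen ((Bundle.TotalSpace.proj : TangentBundle (𝓡 k) H → H) ⁻¹' e.source) :=
    e.open_source.preimage (FiberBundle.continuous_proj _ _)
  have h2 : ContMDiffAt (𝓡 k).tangent (𝓡 k).tangent ∞ (tangentMap (𝓡 k) (𝓡 k) e)
      (⟨b q₀, σ q₀⟩ : TangentBundle (𝓡 k) H) := by
    refine (h1.contMDiffAt (hopen.mem_nhds hq)).congr_of_eventuallyEq ?_
    filter_upwards [hopen.mem_nhds hq] with p hp
    exact (tangentMapWithin_eq_tangentMap (e.open_source.uniqueMDiffWithinAt hp)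
      ((mdifferentiable_of_mem he).mdifferentiableAt hp)).symm
  have h3 := (contMDiff_snd_tangentBundle_modelSpace (n := ∞) (EuclideanSpace ℝ (Fin k)) (𝓡 k)).contMDiffAt
    (x := tangentMap (𝓡 k) (𝓡 k) e ⟨b q₀, σ q₀⟩)
  exact h3.comp q₀ (h2.comp q₀ hσ)

/-- Constant vector fields in a chart are smooth. -/
theorem contMDiffAt_mfderiv_chart_symm (he : e ∈ IsManifold.maximalAtlas (𝓡 k) ∞ H)
    {z : EuclideanSpace ℝ (Fin k)} (hz : z ∈ e.target) (a : EuclideanSpace ℝ (Fin k)) :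
    ContMDiffAt 𝓘(ℝ, EuclideanSpace ℝ (Fin k)) (𝓡 k).tangent ∞
      (fun y => (⟨e.symm y, mfderiv (𝓡 k) (𝓡 k) e.symm y a⟩ : TangentBundle (𝓡 k) H)) z := by
  have : IsManifold (𝓡 k) 1 H := IsManifold.of_le (n := ∞) (by simp)
  have h1 := (contMDiffOn_symm_of_mem_maximalAtlas he).contMDiffOn_tangentMapWithin (m := ∞)
    (by simp) e.open_target.uniqueMDiffOn
  have hopen : IsOpen ((Bundle.TotalSpace.proj : TangentBundle (𝓡 k) (EuclideanSpace ℝ (Fin k)) →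
      EuclideanSpace ℝ (Fin k)) ⁻¹' e.target) :=
    e.open_target.preimage (FiberBundle.continuous_proj _ _)
  have h2 : ContMDiffAt (𝓡 k).tangent (𝓡 k).tangent ∞ (tangentMap (𝓡 k) (𝓡 k) e.symm)
      (⟨z, a⟩ : TangentBundle (𝓡 k) (EuclideanSpace ℝ (Fin k))) := by
    refine (h1.contMDiffAt (hopen.mem_nhds hz)).congr_of_eventuallyEq ?_
    filter_upwards [hopen.mem_nhds hz] with p hp
    exact (tangentMapWithin_eq_tangentMap (e.open_target.uniqueMDiffWithinAt hp)
      ((mdifferentiable_of_mem he).mdifferentiableAt_symm hp)).symm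
  have h3 : ContMDiffAt 𝓘(ℝ, EuclideanSpace ℝ (Fin k)) (𝓡 k).tangent ∞
      (fun y => (⟨y, a⟩ : TangentBundle (𝓡 k) (EuclideanSpace ℝ (Fin k)))) z :=
    contMDiffAt_vectorSpace_iff_contDiffAt.2 contDiffAt_const
  exact h2.comp z h3

end Charts

/-! ### The metric in a chart -/

section Metric
variable {M : Type*} [TopologicalSpace M] [ChartedSpace E3 M] [IsManifold (𝓡 3) ∞ M]
  {y : OpenPartialHomeomorph M E3}

theorem coordMetric_symm (g : Metric M) (z a b : E3) :
    coordMetric g y z a b = coordMetric g y z b a :=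
  g.symm (y.symm z) (mfderiv (𝓡 3) (𝓡 3) y.symm z a) (mfderiv (𝓡 3) (𝓡 3) y.symm z b)

theorem coordMetric_pos (g : Metric M) (hy : y ∈ IsManifold.maximalAtlas (𝓡 3) ∞ M) {z a : E3}
    (hz : z ∈ y.target) (ha : a ≠ 0) : 0 < coordMetric g y z a a := by
  have hinj := (mdifferentiable_of_mem hy).symm.mfderiv_injective hz
  have hD : mfderiv (𝓡 3) (𝓡 3) y.symm z a ≠ 0 :=
    fun h0 => ha (hinj (h0.trans (ContinuousLinearMap.map_zero _).symm))
  exact g.pos (y.symm z) (mfderiv (𝓡 3) (𝓡 3) y.symm z a) hD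

theorem contDiffAt_coordMetric_apply (g : Metric M)
    (hy : y ∈ IsManifold.maximalAtlas (𝓡 3) ∞ M) {w : E3} (hw : w ∈ y.target) (a b : E3) :
    ContDiffAt ℝ ∞ (fun z => coordMetric g y z a b) w := by
  rw [← contMDiffAt_iff_contDiffAt]
  have hs : ContMDiffAt 𝓘(ℝ, E3) (𝓡 3) ∞ y.symm w :=
    (contMDiffOn_symm_of_mem_maximalAtlas hy).contMDiffAt (y.open_target.mem_nhds hw)
  have h1 := ContMDiffAt.clm_bundle_apply₂ (F₁ := E3) (F₂ := E3) (F₃ := ℝ)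
    (E₁ := fun q : M => TangentSpace (𝓡 3) q) (E₂ := fun q : M => TangentSpace (𝓡 3) q)
    (E₃ := Bundle.Trivial M ℝ)
    ((g.contMDiff _).comp w hs) (contMDiffAt_mfderiv_chart_symm hy hw a)
    (contMDiffAt_mfderiv_chart_symm hy hw b)
  exact ((Bundle.contMDiffAt_totalSpace).1 h1).2

theorem isMetricOn_coordMetric (g : Metric M) (hy : y ∈ IsManifold.maximalAtlas (𝓡 3) ∞ M) :
    IsMetricOn (coordMetric g y) y.target where
  isOpen := y.open_target
  symm z _ a b := coordMetric_symm g z a b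
  pos z hz a ha := coordMetric_pos g hy hz ha
  smooth z hz := by
    refine ContDiffOn.contDiffAt ?_ (y.open_target.mem_nhds hz)
    exact contDiffOn_clm_apply.2 fun a => contDiffOn_clm_apply.2 fun b => fun w hw =>
      (contDiffAt_coordMetric_apply g hy hw a b).contDiffWithinAt

/-- The differentials of the chart and of its inverse cancel, so the chart is an isometry; this
carries unit length and normality of `ν` to coordinates. -/
theorem coordMetric_mfderiv (g : Metric M) (hy : y ∈ IsManifold.maximalAtlas (𝓡 3) ∞ M) {m : M}
    (hm : m ∈ y.source) (a b : TangentSpace (𝓡 3) m) :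
    coordMetric g y (y m) (mfderiv (𝓡 3) (𝓡 3) y m a) (mfderiv (𝓡 3) (𝓡 3) y m b) =
      g.inner m a b := by
  have h1 : ∀ a : TangentSpace (𝓡 3) m,
      (mfderiv (𝓡 3) (𝓡 3) y.symm (y m) (mfderiv (𝓡 3) (𝓡 3) y m a) : E3) = a := fun a =>
    DFunLike.congr_fun ((mdifferentiable_of_mem hy).symm_comp_deriv hm) a
  -- The metrics at `y.symm (y m)` and at `m` live on different fibres; both fibres are `E3` by
  -- definition, which allows the comparison.
  have h2 := congrArg (fun m' => (g.inner m' : E3 →L[ℝ] E3 →L[ℝ] ℝ) a b) (y.left_inv hm)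
  refine Eq.trans ?_ h2
  exact congrArg₂ (fun a' b' => (g.inner (y.symm (y m)) : E3 →L[ℝ] E3 →L[ℝ] ℝ) a' b')
    (h1 a) (h1 b)

end Metric

/-! ### Frontals in coordinates -/

section Expressions

variable {S : Type*} [TopologicalSpace S] [ChartedSpace E2 S] [IsManifold (𝓡 2) ∞ S]
  {M : Type*} [TopologicalSpace M] [ChartedSpace E3 M] [IsManifold (𝓡 3) ∞ M]
  {f : S → M} {x : OpenPartialHomeomorph S E2} {y : OpenPartialHomeomorph M E3} {q : S}

theorem contDiffAt_coordMap (hf : ContMDiff (𝓡 2) (𝓡 3) ∞ f)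
    (hx : x ∈ IsManifold.maximalAtlas (𝓡 2) ∞ S) (hy : y ∈ IsManifold.maximalAtlas (𝓡 3) ∞ M)
    {z : E2} (hz : z ∈ x.target) (hfz : f (x.symm z) ∈ y.source) :
    ContDiffAt ℝ ∞ (coordMap x y f) z := by
  rw [← contMDiffAt_iff_contDiffAt]
  have h1 : ContMDiffAt (𝓡 2) (𝓡 2) ∞ x.symm z :=
    (contMDiffOn_symm_of_mem_maximalAtlas hx).contMDiffAt (x.open_target.mem_nhds hz)
  have h2 : ContMDiffAt (𝓡 3) (𝓡 3) ∞ y (f (x.symm z)) :=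
    contMDiffAt_of_mem_maximalAtlas hy hfz
  exact h2.comp z ((hf (x.symm z)).comp z h1)

theorem coordMap_apply (hq : q ∈ x.source) : coordMap x y f (x q) = y (f q) := by
  rw [coordMap, x.left_inv hq]

theorem coordField_apply {η : ∀ q : S, TangentSpace (𝓡 2) q} (hq : q ∈ x.source) :
    coordField x η (x q) = coordVec x q (η q) :=
  congrArg (fun q' => coordVec x q' (η q')) (x.left_inv hq)

/-- Chain rule on both sides of `coordMap x y f ∘ x = y ∘ f`, valid near `q`. -/
theorem fderiv_coordMap (hf : ContMDiff (𝓡 2) (𝓡 3) ∞ f)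
    (hx : x ∈ IsManifold.maximalAtlas (𝓡 2) ∞ S) (hy : y ∈ IsManifold.maximalAtlas (𝓡 3) ∞ M)
    (hq : q ∈ x.source) (hfq : f q ∈ y.source) (w : TangentSpace (𝓡 2) q) :
    fderiv ℝ (coordMap x y f) (x q) (coordVec x q w) =
      (mfderiv (𝓡 3) (𝓡 3) y (f q) (mfderiv (𝓡 2) (𝓡 3) f q w) : E3) := by
  have hF : DifferentiableAt ℝ (coordMap x y f) (x q) :=
    (contDiffAt_coordMap hf hx hy (x.map_source hq)
      (by rwa [x.left_inv hq])).differentiableAt (by simp)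
  have h1 : mfderiv (𝓡 2) (𝓡 3) (coordMap x y f ∘ x) q =
      (mfderiv (𝓡 2) (𝓡 3) (coordMap x y f) (x q)).comp (mfderiv (𝓡 2) (𝓡 2) x q) :=
    mfderiv_comp q hF.mdifferentiableAt ((mdifferentiable_of_mem hx).mdifferentiableAt hq)
  have h2 : mfderiv (𝓡 2) (𝓡 3) (y ∘ f) q =
      (mfderiv (𝓡 3) (𝓡 3) y (f q)).comp (mfderiv (𝓡 2) (𝓡 3) f q) :=
    mfderiv_comp q ((mdifferentiable_of_mem hy).mdifferentiableAt hfq)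
      ((hf q).mdifferentiableAt (by simp))
  have h3 : coordMap x y f ∘ x =ᶠ[𝓝 q] y ∘ f := by
    filter_upwards [x.open_source.mem_nhds hq] with q' hq' using coordMap_apply hq'
  have h4 := DFunLike.congr_fun (h1.symm.trans (h3.mfderiv_eq.trans h2)) w
  rw [mfderiv_eq_fderiv] at h4
  exact h4

theorem coordVec_injective (hx : x ∈ IsManifold.maximalAtlas (𝓡 2) ∞ S) (hq : q ∈ x.source) :
    Function.Injective (coordVec x q) :=
  (mdifferentiable_of_mem hx).mfderiv_injective hq

theorem coordVec_surjective (hx : x ∈ IsManifold.maximalAtlas (𝓡 2) ∞ S) (hq : q ∈ x.source) :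
    Function.Surjective (coordVec x q) :=
  (mdifferentiable_of_mem hx).mfderiv_surjective hq

theorem coordVec_ne_zero (hx : x ∈ IsManifold.maximalAtlas (𝓡 2) ∞ S) (hq : q ∈ x.source)
    {w : TangentSpace (𝓡 2) q} (hw : w ≠ 0) : coordVec x q w ≠ 0 :=
  fun h0 => hw (coordVec_injective hx hq (h0.trans (ContinuousLinearMap.map_zero _).symm))

theorem contDiffAt_coordNormal {ν : ∀ q, TangentSpace (𝓡 3) (f q)} {U : Set S} {g : Metric M}
    (hν : IsUnitNormalOn g f ν U) (hU : IsOpen U)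
    (hx : x ∈ IsManifold.maximalAtlas (𝓡 2) ∞ S) (hy : y ∈ IsManifold.maximalAtlas (𝓡 3) ∞ M)
    {z : E2} (hz : z ∈ x.target) (hzU : x.symm z ∈ U) (hfz : f (x.symm z) ∈ y.source) :
    ContDiffAt ℝ ∞ (coordNormal x y f ν) z := by
  rw [← contMDiffAt_iff_contDiffAt]
  have h1 : ContMDiffAt (𝓡 2) (𝓡 2) ∞ x.symm z :=
    (contMDiffOn_symm_of_mem_maximalAtlas hx).contMDiffAt (x.open_target.mem_nhds hz)
  exact (contMDiffAt_mfderiv_chart hy (hν.smooth.contMDiffAt (hU.mem_nhds hzU)) hfz).comp z h1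

theorem contDiffAt_coordField {η : ∀ q : S, TangentSpace (𝓡 2) q}
    (hx : x ∈ IsManifold.maximalAtlas (𝓡 2) ∞ S) (hq : q ∈ x.source)
    (hη : ContMDiffAt (𝓡 2) (𝓡 2).tangent ∞
      (fun q => (⟨q, η q⟩ : TangentBundle (𝓡 2) S)) q) :
    ContDiffAt ℝ ∞ (coordField x η) (x q) := by
  rw [← contMDiffAt_iff_contDiffAt]
  have h1 : ContMDiffAt (𝓡 2) (𝓡 2) ∞ x.symm (x q) :=
    (contMDiffOn_symm_of_mem_maximalAtlas hx).contMDiffAt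
      (x.open_target.mem_nhds (x.map_source hq))
  have h2 := contMDiffAt_mfderiv_chart hx hη hq
  rw [← x.left_inv hq] at h2
  exact h2.comp (x q) h1

/-- The function `λ` vanishes at the singular points. -/
theorem lam_eq_zero_of_isSingularPt {ν : ∀ q, TangentSpace (𝓡 3) (f q)} {g : Metric M}
    (hf : ContMDiff (𝓡 2) (𝓡 3) ∞ f)
    (hx : x ∈ IsManifold.maximalAtlas (𝓡 2) ∞ S) (hy : y ∈ IsManifold.maximalAtlas (𝓡 3) ∞ M)
    (hq : q ∈ x.source) (hfq : f q ∈ y.source) (hs : IsSingularPt f q) :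
    lam (coordMetric g y) (coordMap x y f) (coordNormal x y f ν) (x q) = 0 := by
  obtain ⟨w₁, w₂, hw, hne⟩ : ∃ w₁ w₂ : TangentSpace (𝓡 2) q,
      mfderiv (𝓡 2) (𝓡 3) f q w₁ = mfderiv (𝓡 2) (𝓡 3) f q w₂ ∧ w₁ ≠ w₂ := by
    simpa [IsSingularPt, Function.Injective] using hs
  set v := coordVec x q w₁ - coordVec x q w₂ with hv_def
  have hv : v ≠ 0 := sub_ne_zero.2 fun h => hne (coordVec_injective hx hq h)
  have hFv : fderiv ℝ (coordMap x y f) (x q) v = 0 := by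
    rw [hv_def, map_sub, sub_eq_zero, fderiv_coordMap hf hx hy hq hfq,
      fderiv_coordMap hf hx hy hq hfq, hw]
  rw [fderiv_eq_smul_pd_add] at hFv
  set z := x q
  set G := coordMetric g y
  set F := coordMap x y f
  set n := coordNormal x y f ν z
  -- Cramer's rule: replacing a column by the null combination `v_0 f_u + v_1 f_v = 0` multiplies
  -- `λ` by a coordinate of `v`.
  have h0 : v 0 * detG G (F z) (pd F 0 z) (pd F 1 z) n = 0 := by
    have h1 : detG G (F z) (v 0 • pd F 0 z + v 1 • pd F 1 z) (pd F 1 z) n = 0 := by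
      rw [hFv]; simpa using detG_smul_left (G := G) (z := F z) 0 (pd F 1 z) (pd F 1 z) n
    rwa [detG_add_left, detG_smul_left, detG_smul_left, detG_self_left, mul_zero, add_zero] at h1
  have h1 : v 1 * detG G (F z) (pd F 0 z) (pd F 1 z) n = 0 := by
    have h1 : detG G (F z) (pd F 0 z) (v 0 • pd F 0 z + v 1 • pd F 1 z) n = 0 := by
      rw [hFv]; simpa using detG_smul_mid (G := G) (z := F z) 0 (pd F 0 z) (pd F 1 z) n
    rwa [detG_add_mid, detG_smul_mid, detG_smul_mid, detG_self_left, mul_zero, zero_add] at h1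
  by_contra hlam
  have e0 := (mul_eq_zero.1 h0).resolve_right hlam
  have e1 := (mul_eq_zero.1 h1).resolve_right hlam
  exact hv (by rw [eq_smul_e2_add v, e0, e1]; simp)

/-- In adapted coordinates a frontal near a singular point of the second kind is an adapted
frontal of the coordinate plane. -/
theorem IsAdapted.exists_isAdaptedFrontal {ν : ∀ q, TangentSpace (𝓡 3) (f q)} {g : Metric M}
    {p : S} {U : Set S} (hf : ContMDiff (𝓡 2) (𝓡 3) ∞ f) (hU : IsOpen U) (hpU : p ∈ U)
    (hν : IsUnitNormalOn g f ν U) (hp : IsNondegenerate g f ν p)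
    (hy : y ∈ IsManifold.maximalAtlas (𝓡 3) ∞ M) (hpy : f p ∈ y.source)
    (hx : IsAdapted g f p x y) :
    ∃ V, (0 : E2) ∈ V ∧ IsAdaptedFrontal (coordMetric g y) y.target (coordMap x y f)
      (coordNormal x y f ν) V := by
  have hxa := hx.mem_atlas
  have hG := isMetricOn_coordMetric g hy
  set G := coordMetric g y with hG_def
  set F := coordMap x y f with hF_def
  set N := coordNormal x y f ν with hN_def
  have h0t : (0 : E2) ∈ x.target := hx.centered ▸ x.map_source hx.mem_source
  have h0s : x.symm 0 = p := by rw [← hx.centered, x.left_inv hx.mem_source]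
  have hsymm : Tendsto x.symm (𝓝 0) (𝓝 p) := by
    have := (x.continuousAt_symm h0t).tendsto
    rwa [h0s] at this
  have hsmooth : ∀ z, z ∈ x.target ∧ x.symm z ∈ U ∧ f (x.symm z) ∈ y.source →
      F z ∈ y.target ∧ ContDiffAt ℝ ∞ F z ∧ ContDiffAt ℝ ∞ N z := fun z ⟨h1, h2, h3⟩ =>
    ⟨y.map_source h3, contDiffAt_coordMap hf hxa hy h1 h3,
      contDiffAt_coordNormal hν hU hxa hy h1 h2 h3⟩
  have hbase : ∀ᶠ z in 𝓝 (0 : E2),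
      z ∈ x.target ∧ x.symm z ∈ U ∧ f (x.symm z) ∈ y.source := by
    filter_upwards [x.open_target.mem_nhds h0t, hsymm.eventually (hU.mem_nhds hpU),
      hsymm.eventually ((hf.continuous.tendsto p).eventually (y.open_source.mem_nhds hpy))]
      with z h1 h2 h3 using ⟨h1, h2, h3⟩
  obtain ⟨hF0Y, hF0, hN0⟩ := hsmooth 0 hbase.self_of_nhds
  have hpd0 : pd F 1 0 ≠ 0 := fun h => by
    have := hx.fv
    rw [← hF_def, h] at this
    simp [normG] at this
  have hpd : ∀ᶠ z in 𝓝 (0 : E2), pd F 1 z ≠ 0 :=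
    (contDiffAt_pd hF0 1).continuousAt.eventually_ne hpd0
  have hlam0 : ContDiffAt ℝ ∞ (lam G F N) 0 :=
    hG.contDiffAt_detG hF0Y hF0 (contDiffAt_pd hF0 0) (contDiffAt_pd hF0 1) hN0
  have haxis : ∀ᶠ z in 𝓝 (0 : E2), z 1 = 0 → lam G F N z = 0 := by
    filter_upwards [hbase, hsymm.eventually hx.axis] with z ⟨h1, _, h3⟩ h4 h5
    have h6 := lam_eq_zero_of_isSingularPt (g := g) (ν := ν) hf hxa hy (x.map_target h1) h3
      (h4.2 (by rw [x.right_inv h1, h5]))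
    rwa [x.right_inv h1] at h6
  -- `λ` vanishes on the axis, so `dλ(p) = λ_v(p) dv`, and non-degeneracy forces `λ_v(p) ≠ 0`.
  have hlv0 : fderiv ℝ (lam G F N) 0 (e2 1) ≠ 0 := fun h => by
    have h1 := hp.2 x hxa y hy hx.mem_source hpy
    rw [hx.centered] at h1
    refine h1 (ContinuousLinearMap.ext fun w => ?_)
    rw [fderiv_eq_of_eq_zero_on_axis (hlam0.differentiableAt (by simp)) haxis (by simp) w, h]
    simp
  have hlv : ∀ᶠ z in 𝓝 (0 : E2), fderiv ℝ (lam G F N) z (e2 1) ≠ 0 :=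
    (contDiffAt_dir hlam0 contDiffAt_const).continuousAt.eventually_ne hlv0
  obtain ⟨V, hV, hVo, h0V⟩ := eventually_nhds_iff.1
    (hbase.and (hpd.and (haxis.and hlv)))
  refine ⟨V, h0V, hG, hVo, fun z hz => (hsmooth z (hV z hz).1).1,
    fun z hz => (hsmooth z (hV z hz).1).2.1, fun z hz => (hsmooth z (hV z hz).1).2.2,
    fun z hz => ?_, fun z hz w => ?_, fun z hz => (hV z hz).2.1, fun z hz => (hV z hz).2.2.1,
    fun z hz => (hV z hz).2.2.2⟩
  · obtain ⟨h1, h2, h3⟩ := (hV z hz).1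
    exact (coordMetric_mfderiv g hy h3 _ _).trans (hν.unit _ h2)
  · obtain ⟨h1, h2, h3⟩ := (hV z hz).1
    obtain ⟨a, ha⟩ := coordVec_surjective hxa (x.map_target h1) w
    have h4 := fderiv_coordMap hf hxa hy (x.map_target h1) h3 a
    rw [x.right_inv h1, ha] at h4
    rw [hF_def, h4]
    exact (coordMetric_mfderiv g hy h3 _ _).trans (hν.normal _ h2 a)

end Expressions

/-! ### Curves in coordinates -/

section Curves

variable {S : Type*} [TopologicalSpace S] [ChartedSpace E2 S] [IsManifold (𝓡 2) ∞ S]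
  {x : OpenPartialHomeomorph S E2} {γ : ℝ → S} {t : ℝ}

theorem contDiffAt_coordCurve (hx : x ∈ IsManifold.maximalAtlas (𝓡 2) ∞ S)
    (hγ : ContMDiffAt 𝓘(ℝ, ℝ) (𝓡 2) ∞ γ t) (ht : γ t ∈ x.source) :
    ContDiffAt ℝ ∞ (fun s => x (γ s)) t := by
  rw [← contMDiffAt_iff_contDiffAt]
  have h1 : ContMDiffAt (𝓡 2) (𝓡 2) ∞ x (γ t) := contMDiffAt_of_mem_maximalAtlas hx ht
  exact h1.comp t hγ

theorem deriv_coordCurve (hx : x ∈ IsManifold.maximalAtlas (𝓡 2) ∞ S)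
    (hγ : ContMDiffAt 𝓘(ℝ, ℝ) (𝓡 2) ∞ γ t) (ht : γ t ∈ x.source) :
    deriv (fun s => x (γ s)) t = coordVec x (γ t) (velocity γ t) := by
  have h1 : mfderiv 𝓘(ℝ, ℝ) (𝓡 2) (x ∘ γ) t =
      (mfderiv (𝓡 2) (𝓡 2) x (γ t)).comp (mfderiv 𝓘(ℝ, ℝ) (𝓡 2) γ t) :=
    mfderiv_comp t ((mdifferentiable_of_mem hx).mdifferentiableAt ht)
      (hγ.mdifferentiableAt (by simp))
  rw [mfderiv_eq_fderiv] at h1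
  exact DFunLike.congr_fun h1 (1 : ℝ)

end Curves

end Frontal

end

/-! ### The main theorem, by reduction to coordinates -/

theorem theorem3
    {S : Type*} [TopologicalSpace S] [ChartedSpace Frontal.E2 S] [IsManifold (𝓡 2) ∞ S]
    {M : Type*} [TopologicalSpace M] [ChartedSpace Frontal.E3 M] [IsManifold (𝓡 3) ∞ M]
    (g : Frontal.Metric M)
    (f : S → M) (hf : ContMDiff (𝓡 2) (𝓡 3) ∞ f)
    (p : S)
    -- a unit normal field of the frontal near the point
    (U : Set S) (hU : IsOpen U) (hpU : p ∈ U)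
    (ν : ∀ q, TangentSpace (𝓡 3) (f q)) (hν : Frontal.IsUnitNormalOn g f ν U)
    -- the singular curve
    (γ : ℝ → S) (δ : ℝ) (hγ : Frontal.IsSingularCurve f p γ δ)
    (hp : Frontal.IsSecondKind g f ν γ 0)
    (hfirst : ∀ᶠ t in 𝓝[≠] (0 : ℝ), Frontal.IsFirstKind g f ν γ t)
    -- adapted coordinates at the point, and coordinates of the ambient manifold
    (x : OpenPartialHomeomorph S Frontal.E2) (y : OpenPartialHomeomorph M Frontal.E3)
    (hy : y ∈ IsManifold.maximalAtlas (𝓡 3) ∞ M) (hpy : f p ∈ y.source)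
    (hx : Frontal.IsAdapted g f p x y)
    -- extended null vector fields at the singular points of the first kind
    (η : ℝ → ∀ q : S, TangentSpace (𝓡 2) q)
    (hη : ∀ᶠ t in 𝓝[≠] (0 : ℝ), Frontal.IsExtendedNull f γ x t (η t)) :
    let G := Frontal.coordMetric g y
    let F := Frontal.coordMap x y f
    let N := Frontal.coordNormal x y f ν
    let c : ℝ → Frontal.E2 := fun t => x (γ t)
    let κs : ℝ → ℝ := fun t => Frontal.kappaS G F N c (Frontal.coordField x (η t)) t
    let κc : ℝ → ℝ := fun t => Frontal.kappaC G F c (Frontal.coordField x (η t)) t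
    let κP : ℝ → ℝ := fun t => Frontal.kappaPi G F N c (Frontal.coordField x (η t)) t
    let κν : ℝ := Frontal.kappaNu G F N 1 0
    ∃ κH : ℝ, Frontal.IsKappaH G F N κH ∧
      (∀ᶠ t in 𝓝[≠] (0 : ℝ), κs t ≠ 0) ∧
      Tendsto (fun t => |κc t| / (2 * |κs t| ^ (1 / 2 : ℝ))) (𝓝[≠] 0) (𝓝 |κH|) ∧
      (κν * κH ≠ 0 → ¬ Tendsto κP (𝓝[≠] 0) (𝓝 (κν * κH))) := by
  intro G F N c κs κc κP κν
  have hxa := hx.mem_atlas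
  obtain ⟨V, h0V, h⟩ := hx.exists_isAdaptedFrontal hf hU hpU hν
    (by have := hp.1; rwa [hγ.base] at this) hy hpy
  have hIoo : ∀ᶠ t in 𝓝 (0 : ℝ), t ∈ Ioo (-δ) δ := Ioo_mem_nhds (by linarith [hγ.pos]) hγ.pos
  have hsm : ∀ t ∈ Ioo (-δ) δ, ContMDiffAt 𝓘(ℝ, ℝ) (𝓡 2) ∞ γ t :=
    fun t ht => hγ.smooth.contMDiffAt (isOpen_Ioo.mem_nhds ht)
  have hγ0 : Tendsto γ (𝓝 0) (𝓝 p) := by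
    have := (hsm 0 hIoo.self_of_nhds).continuousAt.tendsto
    rwa [hγ.base] at this
  have hsrc : ∀ᶠ t in 𝓝 (0 : ℝ), t ∈ Ioo (-δ) δ ∧ γ t ∈ x.source ∧ f (γ t) ∈ y.source := by
    filter_upwards [hIoo, hγ0.eventually (x.open_source.mem_nhds hx.mem_source),
      hγ0.eventually ((hf.continuous.tendsto p).eventually (y.open_source.mem_nhds hpy))]
      with t h1 h2 h3 using ⟨h1, h2, h3⟩
  have hcurve : ∀ᶠ t in 𝓝 (0 : ℝ), ContDiffAt ℝ ∞ c t ∧ deriv c t ≠ 0 ∧ c t 1 = 0 := by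
    filter_upwards [hsrc, hγ0.eventually hx.axis] with t ⟨h1, h2, h3⟩ h4
    refine ⟨Frontal.contDiffAt_coordCurve hxa (hsm t h1) h2, ?_, h4.1 (hγ.singular t h1)⟩
    rw [Frontal.deriv_coordCurve hxa (hsm t h1) h2]
    exact Frontal.coordVec_ne_zero hxa h2 (hγ.regular t h1)
  -- The velocity of the curve is a multiple of `∂_u`; if `f_u` vanished it would be a null vector,
  -- contradicting the first kind.
  have hfst : ∀ᶠ t in 𝓝[≠] (0 : ℝ), Frontal.pd F 0 (c t) ≠ 0 := by
    filter_upwards [hfirst, nhdsWithin_le_nhds hsrc,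
      nhdsWithin_le_nhds (eventually_eventually_nhds.2 hcurve)] with t hft ⟨h1, h2, h3⟩ h4 h0
    have hd := Frontal.deriv_coord_eq_zero (h4.self_of_nhds.1.differentiableAt (by simp))
      (h4.mono fun s hs => hs.2.2)
    have h5 : fderiv ℝ F (c t) (deriv c t) = 0 := by
      rw [Frontal.fderiv_eq_smul_pd_add, h0, hd]
      simp
    rw [Frontal.deriv_coordCurve hxa (hsm t h1) h2] at h5
    have h6 := (Frontal.fderiv_coordMap hf hxa hy h2 h3 (Frontal.velocity γ t)).symm.trans h5
    have h7 := (Frontal.mdifferentiable_of_mem hy).mfderiv_injective h3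
      (h6.trans (ContinuousLinearMap.map_zero _).symm)
    exact hft.2 _ (hγ.regular t h1) h7 ⟨1, (one_smul ℝ _).symm⟩
  have hnull : ∀ᶠ t in 𝓝[≠] (0 : ℝ), ContDiffAt ℝ ∞ (Frontal.coordField x (η t)) (c t) ∧
      Frontal.fη F (Frontal.coordField x (η t)) (c t) = 0 ∧
      Frontal.coordField x (η t) (c t) ≠ 0 := by
    filter_upwards [hη, nhdsWithin_le_nhds hsrc] with t hηt ⟨h1, h2, h3⟩
    obtain ⟨W, hW, hsW, hneW⟩ := hηt.smooth
    refine ⟨Frontal.contDiffAt_coordField hxa h2 (hsW.contMDiffAt hW), ?_, ?_⟩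
    · rw [Frontal.fη, Frontal.coordField_apply h2]
      refine (Frontal.fderiv_coordMap hf hxa hy h2 h3 _).trans ?_
      rw [hηt.null.self_of_nhds]
      exact (mfderiv (𝓡 3) (𝓡 3) y (f (γ t))).map_zero
    · rw [Frontal.coordField_apply h2]
      exact Frontal.coordVec_ne_zero hxa h2 (hneW _ (mem_of_mem_nhds hW))
  have hc0 : c 0 = 0 := by
    change x (γ 0) = 0
    rw [hγ.base, hx.centered]
  exact h.curve_limits h0V hx.fu hx.fv hc0 hcurve hfst hnull
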